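/- Let $(M,h)$ be a smooth Riemannian manifold of dimension $n\ge 1$ (Hausdorff, without boundary), let $W$ be a smooth vector field on $M$ (the wind) and let $|u|_h : M\to\mathbb{R}$ be a smooth function (the ship's own speed), with $|W(x)|_h<|u(x)|_h\le 1$ for all $x\in M$. A *trajectory* is a piecewise $C^1$ curve $\gamma$ in $M$ whose velocity is, at all but finitely many times of each compact interval, $\gamma'(t)=u+W(\gamma(t))$ with $h(u,u)=|u(\gamma(t))|_h^2$. A *solution of the generalized Zermelo navigation problem* on an open interval $J$ is a trajectory $\gamma:J\to M$ that is locally time-optimal: every $t_0\in J$ has a neighbourhood $U$ such that, for all $t_1\le t_2$ in $U\cap J$, no trajectory from $\gamma(t_1)$ to $\gamma(t_2)$ takes less time than $t_2-t_1$. Say that a solution is an *$h$-geodesic up to scaling by $c>0$* if it is a geodesic of $h$ traversed with constant speed $|\gamma'|_h=c$, that is, if $t\mapsto\gamma(t/c)$ is a unit speed $h$-geodesic. Then the following are equivalent: 1. there is one constant $c>0$ such that every solution is an $h$-geodesic up to scaling by $c$; 2. there is one constant $c>0$ such that the solutions on each open interval are exactly the $h$-geodesics of constant speed $c$; 3. $W=0$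 on $M$, and $h(u,u)=|u(x)|_h^2$ does not depend on $x$. -/

import Mathlib

open Set Filter Topology Manifold Bundle
open scoped ContDiff

namespace Zermelo

variable {E : Type*} [NormedAddCommGroup E] [NormedSpace ℝ E]
  {M : Type*} [TopologicalSpace M] [ChartedSpace E M] [IsManifold 𝓘(ℝ, E) ∞ M]

/-- A smooth Riemannian metric on the manifold `M`; `h.inner x v w` is `h(v, w)` for tangent
vectors `v, w` at `x`. -/
abbrev Metric (E : Type*) [NormedAddCommGroup E] [NormedSpace ℝ E]
    (M : Type*) [TopologicalSpace M] [ChartedSpace E M] [IsManifold 𝓘(ℝ, E) ∞ M] :=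
  ContMDiffRiemannianMetric 𝓘(ℝ, E) ∞ E (fun x : M => TangentSpace 𝓘(ℝ, E) x)

/-- The norm `|v|_h = √h(v, v)` of a tangent vector at `x`. -/
noncomputable def hnorm (h : Metric E M) (x : M) (v : TangentSpace 𝓘(ℝ, E) x) : ℝ :=
  Real.sqrt (h.inner x v v)

/-- The velocity `γ'(t)` of a curve in `M`. -/
noncomputable def velocity (E : Type*) [NormedAddCommGroup E] [NormedSpace ℝ E]
    {M : Type*} [TopologicalSpace M] [ChartedSpace E M]
    (γ : ℝ → M) (t : ℝ) : TangentSpace 𝓘(ℝ, E) (γ t) :=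
  mfderiv 𝓘(ℝ, ℝ) 𝓘(ℝ, E) γ t (1 : ℝ)

/-! ### The navigation problem -/

/-- `γ` restricted to `[a, b]` is a possible voyage of a ship whose speed relative to the medium
at the point `x` is `s x`, in the presence of the wind `W`: the curve is piecewise `C¹`, and
outside finitely many times its velocity is `γ' = u + W` with `|u|_h = s`. -/
def IsTrajectory (h : Metric E M) (W : ∀ x : M, TangentSpace 𝓘(ℝ, E) x) (s : M → ℝ)
    (γ : ℝ → M) (a b : ℝ) : Prop :=
  ContinuousOn γ (Icc a b) ∧
  ∃ S : Finset ℝ,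
    (∀ c d : ℝ, a ≤ c → c < d → d ≤ b → (∀ t ∈ Ioo c d, t ∉ S) →
      ContMDiffOn 𝓘(ℝ, ℝ) 𝓘(ℝ, E) 1 γ (Icc c d)) ∧
    ∀ t ∈ Ioo a b, t ∉ S → hnorm h (γ t) (velocity E γ t - W (γ t)) = s (γ t)

/-- `γ`, restricted to the open interval `J`, is a solution of the navigation problem with wind
`W` and ship's own speed `s`: it is a (locally) time-optimal trajectory. Around each time `t₀`,
no voyage from `γ t₁` to `γ t₂` takes less time than the time `t₂ - t₁` that `γ` takes. -/
def IsSolution (h : Metric E M) (W : ∀ x : M, TangentSpace 𝓘(ℝ, E) x) (s : M → ℝ)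
    (γ : ℝ → M) (J : Set ℝ) : Prop :=
  (∀ a ∈ J, ∀ b ∈ J, a ≤ b → IsTrajectory h W s γ a b) ∧
  ∀ t₀ ∈ J, ∃ U ∈ 𝓝 t₀, ∀ t₁ ∈ U ∩ J, ∀ t₂ ∈ U ∩ J, t₁ ≤ t₂ →
    ∀ (σ : ℝ → M) (T : ℝ), 0 ≤ T → IsTrajectory h W s σ 0 T → σ 0 = γ t₁ → σ T = γ t₂ →
      t₂ - t₁ ≤ T

/-! ### Riemannian geodesics -/

/-- The metric in the chart `φ`: the bilinear form `∑ h_ij(y) vⁱ wʲ`. -/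
noncomputable def chartMetric (h : Metric E M) (φ : OpenPartialHomeomorph M E) (y v w : E) : ℝ :=
  h.inner (φ.symm y) (mfderiv 𝓘(ℝ, E) 𝓘(ℝ, E) φ.symm y v) (mfderiv 𝓘(ℝ, E) 𝓘(ℝ, E) φ.symm y w)

/-- The Christoffel symbols of the first kind in the chart `φ`:
`Γ(u, v; w) = ½ (∂_u h(v, w) + ∂_v h(u, w) - ∂_w h(u, v))`. -/
noncomputable def christoffel (h : Metric E M) (φ : OpenPartialHomeomorph M E)
    (y u v w : E) : ℝ :=
  (fderiv ℝ (fun z => chartMetric h φ z v w) y u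
    + fderiv ℝ (fun z => chartMetric h φ z u w) y v
    - fderiv ℝ (fun z => chartMetric h φ z u v) y w) / 2

/-- `γ`, restricted to the open interval `J`, is a geodesic of `h` (with affine parameter): around
each time, in a chart, the curve is `C²` and satisfies the geodesic equation
`h(y'', w) + Γ(y', y'; w) = 0` for all `w`. -/
def IsGeodesic (h : Metric E M) (γ : ℝ → M) (J : Set ℝ) : Prop :=
  ∀ t₀ ∈ J, ∃ φ ∈ atlas E M, (∀ᶠ t in 𝓝 t₀, γ t ∈ φ.source) ∧ ContDiffAt ℝ 2 (φ ∘ γ) t₀ ∧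
    ∀ᶠ t in 𝓝 t₀, ∀ w : E,
      chartMetric h φ (φ (γ t)) (deriv (deriv (φ ∘ γ)) t) w
        + christoffel h φ (φ (γ t)) (deriv (φ ∘ γ) t) (deriv (φ ∘ γ) t) w = 0

/-- `γ` becomes a unit speed geodesic of `h` after rescaling time by the constant `c`: it is a
geodesic traversed with constant speed `c`. -/
def IsGeodesicOfSpeed (h : Metric E M) (c : ℝ) (γ : ℝ → M) (J : Set ℝ) : Prop :=
  IsGeodesic h γ J ∧ ∀ t ∈ J, hnorm h (γ t) (velocity E γ t) = c

end Zermelo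

/-! In a chart, the admissible velocities at `y` form the zero set of `L(y, v) = |v - W|² - s²`, an
ellipsoid whose interior is `L < 0`. Since `|W| < s`, the zero velocity is inside. A trajectory that
needs less time, slowed down to the longer time interval, therefore has `L < 0`. Time-optimality
thus becomes a statement about curves with the same ends on the same interval, one of which has a
smaller `L` pointwise.

That comparison is `IsLagrangianAt.eqOn_of_extremal`. If `x` satisfies `p = μ L_v`, `p' = μ L_x`
with a positive multiplier `μ`, then on a short interval no curve `z` with the same ends has `L(z,
z') ≤ L(x, x')` throughout, except `x` itself. The proof differentiates `p(z - x)` minus a quadratic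
correction. Strict convexity of `L` in the velocity makes this function decrease, and it vanishes at
both ends.

Used with the navigation Lagrangian, it shows that extremals are locally optimal
(`exists_nhds_optimal`). Hamilton's equations give an extremal for each admissible initial velocity
(`exists_extremal`), so solutions with all such velocities exist (`exists_isSolution`). If all of
them have speed `c`, then `|W + u| = |W - u| = c` whenever `|u| = s`. Hence `W` is orthogonal to
every `u`, so `W = 0` and `s = c`.

Conversely, let `W = 0` and `s = c`. Geodesics of speed `c` are extremals with `μ = 1`, hence
solutions. For a given solution, join two nearby points of it by a geodesic taking the same time
(`exists_geodesic_between`). Optimality forbids that geodesic to be slower than `c`, so the solution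
has no larger energy than the geodesic, and the same comparison, now for the energy, makes them
coincide. -/

namespace Zermelo

open scoped NNReal

/-! ### Calculus: exceptional finite sets, Taylor bounds, positive definite forms -/

section Calculus

variable {E F : Type*} [NormedAddCommGroup E] [NormedSpace ℝ E]
  [NormedAddCommGroup F] [NormedSpace ℝ F]

/-! Shortcuts for the instance search on spaces of bilinear maps. -/

section Instances

variable {E F G : Type*} [NormedAddCommGroup E] [NormedSpace ℝ E] [NormedAddCommGroup F]
  [NormedSpace ℝ F] [NormedAddCommGroup G] [NormedSpace ℝ G]

noncomputable instance instSeminormedAddCommGroupBilin :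
    SeminormedAddCommGroup (E →L[ℝ] F →L[ℝ] G) := ContinuousLinearMap.toSeminormedAddCommGroup

noncomputable instance instNormedAddCommGroupBilin :
    NormedAddCommGroup (E →L[ℝ] F →L[ℝ] G) := ContinuousLinearMap.toNormedAddCommGroup

noncomputable instance instNormedSpaceBilin :
    NormedSpace ℝ (E →L[ℝ] F →L[ℝ] G) := ContinuousLinearMap.toNormedSpace

end Instances

/-- A relation between the ends of an interval which is transitive and holds on every interval
whose interior avoids the finite set `S` holds on all intervals. -/
theorem finset_split_induction {P : ℝ → ℝ → Prop} (S : Finset ℝ)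
    (trans : ∀ a b c, a ≤ b → b ≤ c → P a b → P b c → P a c) {a₀ b₀ : ℝ}
    (base : ∀ a b, a₀ ≤ a → a ≤ b → b ≤ b₀ → (∀ t ∈ Ioo a b, t ∉ S) → P a b) (hab : a₀ ≤ b₀) :
    P a₀ b₀ := by
  -- Induction on the size of a set `T` containing the exceptional points inside the interval.
  -- Splitting at one of them removes it from both halves.
  have key : ∀ n : ℕ, ∀ T : Finset ℝ, T.card = n → ∀ a b, a₀ ≤ a → a ≤ b → b ≤ b₀ →
      (∀ t ∈ Ioo a b, t ∈ S → t ∈ T) → P a b := by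
    intro n
    induction n with
    | zero =>
      intro T hT a b ha hab hb h
      rw [Finset.card_eq_zero] at hT
      subst hT
      exact base a b ha hab hb fun t ht hS => by simpa using h t ht hS
    | succ n ih =>
      intro T hT a b ha hab hb h
      by_cases hex : ∃ t ∈ Ioo a b, t ∈ T
      · obtain ⟨s, hs, hsT⟩ := hex
        have hc : (T.erase s).card = n := by rw [Finset.card_erase_of_mem hsT, hT]; rfl
        refine trans a s b hs.1.le hs.2.le
          (ih _ hc a s ha hs.1.le (hs.2.le.trans hb) fun t ht htS => ?_)
          (ih _ hc s b (ha.trans hs.1.le) hs.2.le hb fun t ht htS => ?_)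
        · exact Finset.mem_erase.2 ⟨ht.2.ne, h t ⟨ht.1, ht.2.trans hs.2⟩ htS⟩
        · exact Finset.mem_erase.2 ⟨ht.1.ne', h t ⟨hs.1.trans ht.1, ht.2⟩ htS⟩
      · push Not at hex
        exact base a b ha hab hb fun t ht hS => hex t ht (h t ht hS)
  exact key _ S rfl a₀ b₀ le_rfl hab le_rfl fun t _ h => h

/-- A continuous function whose derivative is nonpositive outside a finite set decreases. -/
theorem le_of_hasDerivAt_nonpos {f f' : ℝ → ℝ} {a b : ℝ} (S : Finset ℝ) (hab : a ≤ b)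
    (hf : ContinuousOn f (Icc a b)) (hd : ∀ t ∈ Ioo a b, t ∉ S → HasDerivAt f (f' t) t)
    (hn : ∀ t ∈ Ioo a b, t ∉ S → f' t ≤ 0) : f b ≤ f a := by
  refine finset_split_induction (P := fun c d => f d ≤ f c) S
    (fun _ _ _ _ _ h₁ h₂ => h₂.trans h₁) (fun c d hc hcd hd' h => ?_) hab
  have hsub : ∀ t ∈ Ioo c d, t ∈ Ioo a b := fun t ht => ⟨hc.trans_lt ht.1, ht.2.trans_le hd'⟩
  have : AntitoneOn f (Icc c d) := by
    refine antitoneOn_of_deriv_nonpos (convex_Icc c d) (hf.mono (Icc_subset_Icc hc hd')) ?_ ?_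
    · rw [interior_Icc]
      exact fun t ht => (hd t (hsub t ht) (h t ht)).differentiableAt.differentiableWithinAt
    · rw [interior_Icc]
      intro t ht
      rw [(hd t (hsub t ht) (h t ht)).deriv]
      exact hn t (hsub t ht) (h t ht)
  exact this (left_mem_Icc.2 hcd) (right_mem_Icc.2 hcd) hcd

/-- The mean value inequality for a continuous curve which is differentiable outside a finite
set. -/
theorem norm_sub_le_of_hasDerivAt_off_finset {f f' : ℝ → E} {a b C : ℝ} (S : Finset ℝ)
    (hab : a ≤ b) (hf : ContinuousOn f (Icc a b))
    (hd : ∀ t ∈ Ioo a b, t ∉ S → HasDerivAt f (f' t) t)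
    (hn : ∀ t ∈ Ioo a b, t ∉ S → ‖f' t‖ ≤ C) : ‖f b - f a‖ ≤ C * (b - a) := by
  refine finset_split_induction (P := fun c d => ‖f d - f c‖ ≤ C * (d - c)) S
    (fun x y z _ _ h₁ h₂ => ?_) (fun c d hc hcd hd' h => ?_) hab
  · calc ‖f z - f x‖ = ‖(f z - f y) + (f y - f x)‖ := by congr 1; abel
      _ ≤ ‖f z - f y‖ + ‖f y - f x‖ := norm_add_le _ _
      _ ≤ C * (z - x) := by linarith
  · have hsub : ∀ t ∈ Ioo c d, t ∈ Ioo a b := fun t ht => ⟨hc.trans_lt ht.1, ht.2.trans_le hd'⟩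
    have hop : ∀ x ∈ Ioo c d, ∀ y ∈ Ioo c d, ‖f y - f x‖ ≤ C * ‖y - x‖ := fun x hx y hy =>
      (convex_Ioo c d).norm_image_sub_le_of_norm_hasDerivWithin_le
        (fun t ht => (hd t (hsub t ht) (h t ht)).hasDerivWithinAt)
        (fun t ht => hn t (hsub t ht) (h t ht)) hx hy
    rcases hcd.eq_or_lt with rfl | hlt
    · simp
    -- Nothing is known about derivatives at the end points, so the bound is extended from the open
    -- interval to its closure by continuity.
    have hcl : ∀ p ∈ Icc c d ×ˢ Icc c d, ‖f p.2 - f p.1‖ ≤ C * ‖p.2 - p.1‖ := by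
      have hfc := hf.mono (Icc_subset_Icc hc hd')
      have e : Icc c d ×ˢ Icc c d = closure (Ioo c d ×ˢ Ioo c d) := by
        rw [closure_prod_eq, closure_Ioo hlt.ne]
      intro p hp
      rw [e] at hp
      refine ContinuousWithinAt.closure_le hp ?_ ?_ (fun q hq => hop q.1 hq.1 q.2 hq.2)
      · have h1 : ContinuousOn (fun q : ℝ × ℝ => ‖f q.2 - f q.1‖) (Icc c d ×ˢ Icc c d) :=
          ((hfc.comp continuousOn_snd fun q hq => hq.2).sub
            (hfc.comp continuousOn_fst fun q hq => hq.1)).norm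
        exact (h1 p (e ▸ hp)).mono (prod_mono Ioo_subset_Icc_self Ioo_subset_Icc_self)
      · fun_prop
    have := hcl (c, d) ⟨left_mem_Icc.2 hcd, right_mem_Icc.2 hcd⟩
    simpa [abs_of_nonneg (sub_nonneg.2 hcd)] using this

/-- First order Taylor estimates, uniform near a point. -/
theorem exists_taylor_bound {f : E → F} {y₀ : E} (hf : ContDiffAt ℝ 2 f y₀) :
    ∃ K > 0, ∃ r > 0, ∀ x ∈ Metric.ball y₀ r, ∀ y ∈ Metric.ball y₀ r,
      ‖f y - f x‖ ≤ K * ‖y - x‖ ∧ ‖f y - f x - fderiv ℝ f x (y - x)‖ ≤ K * ‖y - x‖ ^ 2 := by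
  obtain ⟨K₁, s₁, hs₁, hL₁⟩ := (hf.of_le one_le_two).exists_lipschitzOnWith
  obtain ⟨K₂, s₂, hs₂, hL₂⟩ :=
    (hf.fderiv_right (m := 1) (by norm_num)).exists_lipschitzOnWith
  have hdiff : ∀ᶠ y in 𝓝 y₀, DifferentiableAt ℝ f y :=
    (hf.eventually (by simp)).mono fun y hy => hy.differentiableAt (by norm_num)
  obtain ⟨r, hr, hball⟩ := Metric.mem_nhds_iff.1 (inter_mem (inter_mem hs₁ hs₂) hdiff)
  refine ⟨max (K₁ : ℝ) K₂ + 1, by positivity, r, hr, fun x hx y hy => ⟨?_, ?_⟩⟩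
  · calc ‖f y - f x‖ ≤ K₁ * ‖y - x‖ := hL₁.norm_sub_le (hball hy).1.1 (hball hx).1.1
      _ ≤ _ := by
        gcongr
        linarith [le_max_left (K₁ : ℝ) K₂]
  · have hseg : segment ℝ x y ⊆ Metric.ball y₀ r := (convex_ball y₀ r).segment_subset hx hy
    have := (convex_segment x y).norm_image_sub_le_of_norm_hasFDerivWithin_le'
      (f := f) (f' := fderiv ℝ f) (φ := fderiv ℝ f x) (C := K₂ * ‖y - x‖)
      (fun z hz => (hball (hseg hz)).2.hasFDerivAt.hasFDerivWithinAt)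
      (fun z hz => by
        refine (hL₂.norm_sub_le (hball (hseg hz)).1.2 (hball hx).1.2).trans ?_
        gcongr
        rw [segment_eq_image'] at hz
        obtain ⟨θ, hθ, rfl⟩ := hz
        simp only [add_sub_cancel_left, norm_smul, Real.norm_eq_abs, abs_of_nonneg hθ.1]
        exact mul_le_of_le_one_left (norm_nonneg _) hθ.2)
      (left_mem_segment ℝ x y) (right_mem_segment ℝ x y)
    refine this.trans ?_
    rw [mul_assoc, ← sq]
    gcongr
    linarith [le_max_right (K₁ : ℝ) K₂]

theorem abs_form_apply_le (A : E →L[ℝ] E →L[ℝ] ℝ) (v w : E) : |A v w| ≤ ‖A‖ * ‖v‖ * ‖w‖ :=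
  A.le_opNorm₂ v w

theorem eventually_norm_sub_lt {E F : Type*} [NormedAddCommGroup E] [NormedAddCommGroup F]
    {f : E → F} {y₀ : E} (hf : ContinuousAt f y₀) {a : ℝ}
    (ha : 0 < a) : ∀ᶠ y in 𝓝 y₀, ‖f y - f y₀‖ < a := by
  simpa only [dist_eq_norm] using Metric.continuousAt_iff'.1 hf a ha

/-- A positive definite form on a finite dimensional space is bounded below, uniformly near it. -/
theorem exists_posDef_lower_bound [FiniteDimensional ℝ E] {A : E → E →L[ℝ] E →L[ℝ] ℝ} {y₀ : E}
    (hA : ContinuousAt A y₀) (hpos : ∀ v, v ≠ 0 → 0 < A y₀ v v) :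
    ∃ a > 0, ∀ᶠ y in 𝓝 y₀, ∀ v, a * ‖v‖ ^ 2 ≤ A y v v := by
  have h0 : ∃ a > 0, ∀ v, a * ‖v‖ ^ 2 ≤ A y₀ v v := by
    rcases subsingleton_or_nontrivial E with hE | hE
    · exact ⟨1, one_pos, fun v => by simp [Subsingleton.elim v 0]⟩
    obtain ⟨u, hu, hmin⟩ := (isCompact_sphere (0 : E) 1).exists_isMinOn
      (NormedSpace.sphere_nonempty.2 zero_le_one) (f := fun v => A y₀ v v)
      ((A y₀).continuous.clm_apply continuous_id).continuousOn
    have hu0 : u ≠ 0 := by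
      rintro rfl
      simp at hu
    refine ⟨A y₀ u u, hpos u hu0, fun v => ?_⟩
    rcases eq_or_ne v 0 with rfl | hv
    · simp
    have hv' : ‖v‖ ≠ 0 := norm_ne_zero_iff.2 hv
    have := hmin (a := ‖v‖⁻¹ • v) (by simp [norm_smul, hv'])
    simp only [mem_ofPred_eq, map_smul, smul_apply, smul_eq_mul] at this
    calc A y₀ u u * ‖v‖ ^ 2 ≤ (‖v‖⁻¹ * (‖v‖⁻¹ * A y₀ v v)) * ‖v‖ ^ 2 := by gcongr
      _ = A y₀ v v := by field_simp
  obtain ⟨a, ha, h⟩ := h0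
  refine ⟨a / 2, half_pos ha, ?_⟩
  filter_upwards [eventually_norm_sub_lt (F := E →L[ℝ] E →L[ℝ] ℝ) hA (half_pos ha)] with y hy v
  have h1 : |(A y - A y₀) v v| ≤ a / 2 * ‖v‖ ^ 2 := by
    calc |(A y - A y₀) v v| ≤ ‖A y - A y₀‖ * ‖v‖ * ‖v‖ := abs_form_apply_le _ v v
      _ ≤ a / 2 * ‖v‖ * ‖v‖ := by gcongr
      _ = _ := by ring
  have h2 : A y v v = A y₀ v v + (A y - A y₀) v v := by simp
  have := h v
  have := neg_le_of_abs_le h1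
  linarith

end Calculus

/-! ### Quadratic Lagrangians and uniqueness of short minimizers -/

section Lagrangian

variable {E : Type*} [NormedAddCommGroup E] [NormedSpace ℝ E]

/-- The function `A(v, v) + B(v) + D` of position and velocity, quadratic in the velocity. -/
noncomputable def lag (A : E → E →L[ℝ] E →L[ℝ] ℝ) (B : E → E →L[ℝ] ℝ) (D : E → ℝ) (y v : E) : ℝ :=
  A y v v + B y v + D y

/-- The derivative of `lag A B D` with respect to the velocity. -/
noncomputable def lagV (A : E → E →L[ℝ] E →L[ℝ] ℝ) (B : E → E →L[ℝ] ℝ) (y v : E) : E →L[ℝ] ℝ :=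
  (2 : ℝ) • A y v + B y

/-- The derivative of `lag A B D` with respect to the position. -/
noncomputable def lagX (A : E → E →L[ℝ] E →L[ℝ] ℝ) (B : E → E →L[ℝ] ℝ) (D : E → ℝ)
    (y v : E) : E →L[ℝ] ℝ :=
  ((fderiv ℝ A y).flip v).flip v + (fderiv ℝ B y).flip v + fderiv ℝ D y

theorem lagV_apply (A : E → E →L[ℝ] E →L[ℝ] ℝ) (B : E → E →L[ℝ] ℝ) (y v w : E) :
    lagV A B y v w = 2 * A y v w + B y w := by
  simp [lagV]

theorem lagX_apply (A : E → E →L[ℝ] E →L[ℝ] ℝ) (B : E → E →L[ℝ] ℝ) (D : E → ℝ) (y v ξ : E) :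
    lagX A B D y v ξ = fderiv ℝ A y ξ v v + fderiv ℝ B y ξ v + fderiv ℝ D y ξ := by
  simp [lagX]

/-- The coefficients of a quadratic Lagrangian are `C²` at `y₀`, and its leading part is symmetric
and positive definite. -/
structure IsLagrangianAt (A : E → E →L[ℝ] E →L[ℝ] ℝ) (B : E → E →L[ℝ] ℝ) (D : E → ℝ)
    (y₀ : E) : Prop where
  contDiffAt_A : ContDiffAt ℝ 2 A y₀
  contDiffAt_B : ContDiffAt ℝ 2 B y₀
  contDiffAt_D : ContDiffAt ℝ 2 D y₀
  symm : ∀ᶠ y in 𝓝 y₀, ∀ v w, A y v w = A y w v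
  pos : ∀ v, v ≠ 0 → 0 < A y₀ v v

variable {A : E → E →L[ℝ] E →L[ℝ] ℝ} {B : E → E →L[ℝ] ℝ} {D : E → ℝ} {y₀ : E}

/-- A quadratic Lagrangian lies above its first order expansion, up to an error which is quadratic
in the displacement only. -/
theorem IsLagrangianAt.exists_lower_bound [FiniteDimensional ℝ E] (hL : IsLagrangianAt A B D y₀)
    (R : ℝ) :
    ∃ a > 0, ∃ C > 0, ∃ r > 0, ∀ x ∈ Metric.ball y₀ r, ∀ y ∈ Metric.ball y₀ r, ∀ v, ‖v‖ ≤ R →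
      ∀ u, lag A B D x v + lagX A B D x v (y - x) + lagV A B x v (u - v) + a * ‖u - v‖ ^ 2
        - C * ‖y - x‖ ^ 2 ≤ lag A B D y u := by
  obtain ⟨a, ha, hpos⟩ := exists_posDef_lower_bound hL.contDiffAt_A.continuousAt hL.pos
  obtain ⟨K₁, hK₁, r₁, hr₁, h₁⟩ := exists_taylor_bound hL.contDiffAt_A
  obtain ⟨K₂, hK₂, r₂, hr₂, h₂⟩ := exists_taylor_bound hL.contDiffAt_B
  obtain ⟨K₃, hK₃, r₃, hr₃, h₃⟩ := exists_taylor_bound hL.contDiffAt_D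
  obtain ⟨r₀, hr₀, h₀⟩ := Metric.mem_nhds_iff.1 (hL.symm.and hpos)
  -- `k` is the coefficient of the mixed error `‖y - x‖ ‖u - v‖`. Young's inequality charges half of
  -- the convexity constant `a` for it and puts `k² / (2a)` into the constant of `‖y - x‖²`.
  set k : ℝ := 2 * K₁ * |R| + K₂ with hk
  refine ⟨a / 2, half_pos ha, K₁ * |R| ^ 2 + K₂ * |R| + K₃ + k ^ 2 / (2 * a), by positivity,
    min (min r₀ r₁) (min r₂ r₃), by positivity, fun x hx y hy v hv u => ?_⟩
  have hsub : ∀ z ∈ Metric.ball y₀ (min (min r₀ r₁) (min r₂ r₃)), z ∈ Metric.ball y₀ r₀ ∧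
      z ∈ Metric.ball y₀ r₁ ∧ z ∈ Metric.ball y₀ r₂ ∧ z ∈ Metric.ball y₀ r₃ := fun z hz => by
    simp only [Metric.mem_ball, lt_min_iff] at hz ⊢
    tauto
  obtain ⟨hx₀, hx₁, hx₂, hx₃⟩ := hsub x hx
  obtain ⟨hy₀, hy₁, hy₂, hy₃⟩ := hsub y hy
  obtain ⟨hA₁, hA₂⟩ := h₁ x hx₁ y hy₁
  obtain ⟨hB₁, hB₂⟩ := h₂ x hx₂ y hy₂
  obtain ⟨-, hD₂⟩ := h₃ x hx₃ y hy₃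
  have hsymm := (h₀ hy₀).1
  have hlow := (h₀ hy₀).2 (u - v)
  have hR : ‖v‖ ≤ |R| := hv.trans (le_abs_self R)
  set w := u - v with hw
  set ξ := y - x with hξ
  have hu : u = v + w := by simp [hw]
  have e₁ : |(A y - A x - fderiv ℝ A x ξ) v v| ≤ K₁ * ‖ξ‖ ^ 2 * |R| * |R| :=
    (abs_form_apply_le _ v v).trans (by gcongr)
  have e₂ : |(A y - A x) v w| ≤ K₁ * ‖ξ‖ * |R| * ‖w‖ :=
    (abs_form_apply_le _ v w).trans (by gcongr)
  have e₃ : |(B y - B x - fderiv ℝ B x ξ) v| ≤ K₂ * ‖ξ‖ ^ 2 * |R| :=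
    ((B y - B x - fderiv ℝ B x ξ).le_opNorm v).trans (by gcongr)
  have e₄ : |(B y - B x) w| ≤ K₂ * ‖ξ‖ * ‖w‖ :=
    ((B y - B x).le_opNorm w).trans (by gcongr)
  have e₅ : |D y - D x - fderiv ℝ D x ξ| ≤ K₃ * ‖ξ‖ ^ 2 := hD₂
  -- The Lagrangian is exactly quadratic in the velocity, so the only remainders come from Taylor
  -- expansion of the coefficients in the position.
  have key : lag A B D y u - (lag A B D x v + lagX A B D x v ξ + lagV A B x v w) =
      A y w w + (A y - A x - fderiv ℝ A x ξ) v v + 2 * (A y - A x) v w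
        + (B y - B x - fderiv ℝ B x ξ) v + (B y - B x) w + (D y - D x - fderiv ℝ D x ξ) := by
    rw [lagX_apply, lagV_apply, hu]
    simp only [lag, map_add, add_apply, sub_apply, hsymm w v]
    ring
  have hyoung : k * (‖ξ‖ * ‖w‖) ≤ a / 2 * ‖w‖ ^ 2 + k ^ 2 / (2 * a) * ‖ξ‖ ^ 2 := by
    have : a / 2 * ‖w‖ ^ 2 + k ^ 2 / (2 * a) * ‖ξ‖ ^ 2 - k * (‖ξ‖ * ‖w‖) =
        (a * ‖w‖ - k * ‖ξ‖) ^ 2 / (2 * a) := by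
      field_simp
      ring
    have : 0 ≤ (a * ‖w‖ - k * ‖ξ‖) ^ 2 / (2 * a) := by positivity
    linarith
  have hkk : k * (‖ξ‖ * ‖w‖) = 2 * (K₁ * ‖ξ‖ * |R| * ‖w‖) + K₂ * ‖ξ‖ * ‖w‖ := by
    rw [hk]
    ring
  have := neg_le_of_abs_le e₁
  have := neg_le_of_abs_le e₂
  have := neg_le_of_abs_le e₃
  have := neg_le_of_abs_le e₄
  have := neg_le_of_abs_le e₅
  linarith

/-- Short extremals are the only minimizers, in the following sense. Let `x` be a curve with
velocity `v` which satisfies the Euler–Lagrange equation of `μ(t) lag(x, v)`. A curve `z` with the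
same ends whose Lagrangian is nowhere larger coincides with `x`. -/
theorem IsLagrangianAt.eqOn_of_extremal [FiniteDimensional ℝ E] (hL : IsLagrangianAt A B D y₀)
    (R : ℝ) {m₀ m₁ : ℝ} (hm₀ : 0 < m₀) :
    ∃ r > 0, ∃ ε > 0, ∀ (t₁ t₂ : ℝ) (x v z u : ℝ → E) (p : ℝ → E →L[ℝ] ℝ) (μ : ℝ → ℝ)
      (S : Finset ℝ), t₂ - t₁ ≤ ε →
      (∀ t ∈ Icc t₁ t₂, x t ∈ Metric.ball y₀ r) → (∀ t ∈ Icc t₁ t₂, ‖v t‖ ≤ R) →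
      (∀ t ∈ Icc t₁ t₂, m₀ ≤ μ t ∧ μ t ≤ m₁) →
      (∀ t ∈ Icc t₁ t₂, HasDerivAt x (v t) t) →
      (∀ t ∈ Icc t₁ t₂, p t = μ t • lagV A B (x t) (v t)) →
      (∀ t ∈ Icc t₁ t₂, HasDerivAt p (μ t • lagX A B D (x t) (v t)) t) →
      ContinuousOn z (Icc t₁ t₂) → (∀ t ∈ Icc t₁ t₂, z t ∈ Metric.ball y₀ r) →
      (∀ t ∈ Ioo t₁ t₂, t ∉ S → HasDerivAt z (u t) t) →
      (∀ t ∈ Ioo t₁ t₂, t ∉ S → lag A B D (z t) (u t) ≤ lag A B D (x t) (v t)) →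
      z t₁ = x t₁ → z t₂ = x t₂ → EqOn z x (Icc t₁ t₂) := by
  obtain ⟨a, ha, C, hC, r, hr, hlow⟩ := hL.exists_lower_bound R
  obtain ⟨q, hq, hpos⟩ := exists_posDef_lower_bound hL.contDiffAt_A.continuousAt hL.pos
  replace hpos := hpos.self_of_nhds
  have hsymm := hL.symm.self_of_nhds
  set Q := A y₀ with hQ
  -- `N` is chosen so that `N Q(ξ, ξ)` dominates the error of the lower bound and the Young
  -- remainder of the cross term, with `‖ξ‖²` to spare. Intervals of length at most `N⁻¹` keep the
  -- weight `N (t - t₁)` below `1`.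
  set N : ℝ := (|m₁| * C + ‖Q‖ ^ 2 / (m₀ * a) + 1) / q with hN
  have hNpos : 0 < N := by positivity
  refine ⟨r, hr, N⁻¹, by positivity, ?_⟩
  intro t₁ t₂ x v z u p μ S hε hx hv hμ hxd hp hpd hz hzr hzd hle h1 h2
  set ξ : ℝ → E := fun t => z t - x t with hξ
  -- Along the extremal, the derivative of `p(ξ)` is `μ` times the first variation of the
  -- Lagrangian. By convexity and the hypothesis on `z`, it is at most a multiple of `‖ξ‖²` minus a
  -- multiple of `‖ξ'‖²`. Differentiating the weight of the second term supplies the negative `‖ξ‖²`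
  -- that is missing.
  set Ψ : ℝ → ℝ := fun t => p t (ξ t) + (-N * (t - t₁)) * Q (ξ t) (ξ t) with hΨ
  set Ψ' : ℝ → ℝ := fun t => (μ t • lagX A B D (x t) (v t)) (ξ t) + p t (u t - v t)
    + (-N * Q (ξ t) (ξ t) + (-N * (t - t₁)) * (Q (u t - v t) (ξ t) + Q (ξ t) (u t - v t))) with hΨ'
  have hxc : ContinuousOn x (Icc t₁ t₂) := fun t ht => (hxd t ht).continuousAt.continuousWithinAt
  have hpc : ContinuousOn p (Icc t₁ t₂) := fun t ht => (hpd t ht).continuousAt.continuousWithinAt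
  have hξc : ContinuousOn ξ (Icc t₁ t₂) := hz.sub hxc
  have hΨc : ContinuousOn Ψ (Icc t₁ t₂) := by
    refine (hpc.clm_apply hξc).add (ContinuousOn.mul (by fun_prop) ?_)
    exact (Q.continuous.comp_continuousOn hξc).clm_apply hξc
  have hd : ∀ t ∈ Ioo t₁ t₂, t ∉ S → HasDerivAt Ψ (Ψ' t) t := by
    intro t ht htS
    have ht' := Ioo_subset_Icc_self ht
    have hξd : HasDerivAt ξ (u t - v t) t := (hzd t ht htS).sub (hxd t ht')
    have d1 : HasDerivAt (fun t => p t (ξ t)) _ t := (hpd t ht').clm_apply hξd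
    have d2 : HasDerivAt (fun t => -N * (t - t₁)) (-N) t := by
      simpa using ((hasDerivAt_id t).sub_const t₁).const_mul (-N)
    have d3 : HasDerivAt (fun t => Q (ξ t) (ξ t)) (Q (u t - v t) (ξ t) + Q (ξ t) (u t - v t)) t :=
      (Q.hasFDerivAt.comp_hasDerivAt t hξd).clm_apply hξd
    exact d1.add (d2.mul d3)
  have hn : ∀ t ∈ Ioo t₁ t₂, t ∉ S → Ψ' t ≤ -‖ξ t‖ ^ 2 := by
    intro t ht htS
    have ht' := Ioo_subset_Icc_self ht
    have hmu := hμ t ht'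
    have hmu0 : 0 < μ t := hm₀.trans_le hmu.1
    have hl := hlow (x t) (hx t ht') (z t) (hzr t ht') (v t) (hv t ht') (u t)
    have hG := hle t ht htS
    set w := u t - v t with hw
    have hNt : N * (t - t₁) ≤ 1 := by
      have : t - t₁ ≤ N⁻¹ := by linarith [ht.2]
      calc N * (t - t₁) ≤ N * N⁻¹ := by gcongr
        _ = 1 := mul_inv_cancel₀ hNpos.ne'
    have hNt0 : 0 ≤ N * (t - t₁) := mul_nonneg hNpos.le (sub_nonneg.2 ht.1.le)
    have b1 : μ t * (lagX A B D (x t) (v t) (ξ t) + lagV A B (x t) (v t) w) ≤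
        |m₁| * C * ‖ξ t‖ ^ 2 - m₀ * a * ‖w‖ ^ 2 := by
      have c1 : lagX A B D (x t) (v t) (ξ t) + lagV A B (x t) (v t) w ≤
          C * ‖ξ t‖ ^ 2 - a * ‖w‖ ^ 2 := by
        simp only [hξ]
        linarith
      have c2 : μ t * (C * ‖ξ t‖ ^ 2) ≤ |m₁| * (C * ‖ξ t‖ ^ 2) := by
        gcongr
        exact hmu.2.trans (le_abs_self _)
      have c3 : m₀ * (a * ‖w‖ ^ 2) ≤ μ t * (a * ‖w‖ ^ 2) := by
        gcongr
        exact hmu.1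
      have := mul_le_mul_of_nonneg_left c1 hmu0.le
      linarith
    have b2 : |Q (ξ t) w| ≤ ‖Q‖ * ‖ξ t‖ * ‖w‖ := abs_form_apply_le _ _ _
    have b3 : (-N * (t - t₁)) * (Q w (ξ t) + Q (ξ t) w) ≤ 2 * (‖Q‖ * ‖ξ t‖ * ‖w‖) := by
      rw [hsymm w (ξ t)]
      have c1 : (-N * (t - t₁)) * (Q (ξ t) w + Q (ξ t) w) =
          2 * ((N * (t - t₁)) * (-Q (ξ t) w)) := by
        ring
      have c2 : (N * (t - t₁)) * (-Q (ξ t) w) ≤ 1 * (‖Q‖ * ‖ξ t‖ * ‖w‖) :=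
        (mul_le_mul_of_nonneg_left (show -Q (ξ t) w ≤ ‖Q‖ * ‖ξ t‖ * ‖w‖ by
          linarith [neg_le_of_abs_le b2]) hNt0).trans (by gcongr)
      linarith
    have b4 : 2 * (‖Q‖ * ‖ξ t‖ * ‖w‖) ≤ m₀ * a * ‖w‖ ^ 2 + ‖Q‖ ^ 2 / (m₀ * a) * ‖ξ t‖ ^ 2 := by
      have : m₀ * a * ‖w‖ ^ 2 + ‖Q‖ ^ 2 / (m₀ * a) * ‖ξ t‖ ^ 2 - 2 * (‖Q‖ * ‖ξ t‖ * ‖w‖) =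
          (m₀ * a * ‖w‖ - ‖Q‖ * ‖ξ t‖) ^ 2 / (m₀ * a) := by
        field_simp
        ring
      have : 0 ≤ (m₀ * a * ‖w‖ - ‖Q‖ * ‖ξ t‖) ^ 2 / (m₀ * a) := by positivity
      linarith
    have b5 : N * (q * ‖ξ t‖ ^ 2) ≤ N * Q (ξ t) (ξ t) := by
      gcongr
      exact hpos (ξ t)
    have b6 : N * (q * ‖ξ t‖ ^ 2) = (|m₁| * C + ‖Q‖ ^ 2 / (m₀ * a) + 1) * ‖ξ t‖ ^ 2 := by
      rw [hN]
      field_simp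
    have e : Ψ' t = μ t * (lagX A B D (x t) (v t) (ξ t) + lagV A B (x t) (v t) w)
        + (-(N * Q (ξ t) (ξ t)) + (-N * (t - t₁)) * (Q w (ξ t) + Q (ξ t) w)) := by
      simp only [hΨ', hp t ht', smul_apply, smul_eq_mul]
      ring
    rw [e]
    linarith
  have hξ1 : ξ t₁ = 0 := by simp [hξ, h1]
  have hξ2 : ξ t₂ = 0 := by simp [hξ, h2]
  have hΨ1 : Ψ t₁ = 0 := by simp [hΨ, hξ1]
  have hΨ2 : Ψ t₂ = 0 := by simp [hΨ, hξ2]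
  have hmono : ∀ c d, t₁ ≤ c → c ≤ d → d ≤ t₂ → Ψ d ≤ Ψ c := fun c d hc hcd hd' =>
    le_of_hasDerivAt_nonpos S hcd (hΨc.mono (Icc_subset_Icc hc hd'))
      (fun t ht => hd t ⟨hc.trans_lt ht.1, ht.2.trans_le hd'⟩)
      (fun t ht htS => (hn t ⟨hc.trans_lt ht.1, ht.2.trans_le hd'⟩ htS).trans
        (neg_nonpos.2 (by positivity)))
  have hzero : ∀ t ∈ Icc t₁ t₂, Ψ t = 0 := fun t ht =>
    le_antisymm (hΨ1 ▸ hmono t₁ t le_rfl ht.1 ht.2) (hΨ2 ▸ hmono t t₂ ht.1 ht.2 le_rfl)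
  have hoff : ∀ t ∈ Ioo t₁ t₂, t ∉ S → ξ t = 0 := by
    intro t ht htS
    have h0 : HasDerivAt Ψ 0 t := by
      refine (hasDerivAt_const t (0 : ℝ)).congr_of_eventuallyEq ?_
      filter_upwards [Ioo_mem_nhds ht.1 ht.2] with s hs
      exact hzero s (Ioo_subset_Icc_self hs)
    have := hn t ht htS
    rw [(hd t ht htS).unique h0] at this
    have : ‖ξ t‖ ^ 2 ≤ 0 := by linarith
    exact norm_eq_zero.1 (pow_eq_zero_iff (two_ne_zero) |>.1 (le_antisymm this (by positivity)))
  intro t ht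
  rw [← sub_eq_zero]
  change ξ t = 0
  rcases ht.1.eq_or_lt with rfl | hlt1
  · exact hξ1
  rcases ht.2.eq_or_lt with rfl | hlt2
  · exact hξ2
  -- Only an exceptional point can remain. A punctured neighbourhood of it avoids `S`, so continuity
  -- of `ξ` excludes a nonzero value.
  by_contra hne
  have hca : ContinuousAt ξ t := hξc.continuousAt (Icc_mem_nhds hlt1 hlt2)
  have hev : ∀ᶠ s in 𝓝[≠] t, ξ s ≠ 0 ∧ s ∈ Ioo t₁ t₂ :=
    ((hca.eventually_ne hne).and (Ioo_mem_nhds hlt1 hlt2)).filter_mono nhdsWithin_le_nhds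
  have hS : ∀ᶠ s in 𝓝[≠] t, s ∉ S := by
    have hc : IsClosed ((S.erase t : Finset ℝ) : Set ℝ) := (Finset.finite_toSet _).isClosed
    have h' : ∀ᶠ s in 𝓝[≠] t, s ∉ ((S.erase t : Finset ℝ) : Set ℝ) :=
      (hc.isOpen_compl.mem_nhds (by simp) : _ ∈ 𝓝 t) |> nhdsWithin_le_nhds
    filter_upwards [h', self_mem_nhdsWithin] with s hs hst hsS
    exact hs (by simpa using ⟨hsS, hst⟩)
  obtain ⟨s, ⟨hs1, hs2⟩, hs3⟩ := (hev.and hS).exists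
  exact hs1 (hoff s hs2 hs3)

end Lagrangian

/-! ### Existence of extremals through Hamilton's equations -/

section Existence

variable {E : Type*} [NormedAddCommGroup E] [NormedSpace ℝ E]

/-- Positivity gives a trivial kernel, and a space and its dual have the same finite dimension. -/
theorem isInvertible_of_pos [FiniteDimensional ℝ E] {g : E →L[ℝ] E →L[ℝ] ℝ}
    (hg : ∀ v, v ≠ 0 → 0 < g v v) : g.IsInvertible := by
  have hinj : Function.Injective g := by
    rw [injective_iff_map_eq_zero]
    intro v hv
    by_contra hne
    have := hg v hne
    rw [hv] at this
    simp at this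
  have hdim : Module.finrank ℝ E = Module.finrank ℝ (E →L[ℝ] ℝ) := by
    rw [← (LinearMap.toContinuousLinearMap (𝕜 := ℝ) (E := E) (F' := ℝ)).finrank_eq]
    exact Subspace.dual_finrank_eq.symm
  refine ⟨(LinearEquiv.ofInjectiveOfFinrankEq (g : E →ₗ[ℝ] E →L[ℝ] ℝ) hinj
    hdim).toContinuousLinearEquiv, ?_⟩
  ext v w
  rfl

theorem contDiffAt_inverse [FiniteDimensional ℝ E] {n : WithTop ℕ∞} {g : E → E →L[ℝ] E →L[ℝ] ℝ}
    {y₀ : E} (hg : ContDiffAt ℝ n g y₀) (hpos : ∀ v, v ≠ 0 → 0 < g y₀ v v) :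
    ContDiffAt ℝ n (fun y => (g y).inverse) y₀ := by
  have := FiniteDimensional.complete ℝ E
  obtain ⟨e, he⟩ := isInvertible_of_pos hpos
  have := contDiffAt_map_inverse (𝕜 := ℝ) (n := n) e
  rw [he] at this
  exact this.comp y₀ hg

theorem contDiffAt_flip {X F G : Type*} [NormedAddCommGroup X] [NormedSpace ℝ X]
    [NormedAddCommGroup F] [NormedSpace ℝ F] [NormedAddCommGroup G] [NormedSpace ℝ G]
    {n : WithTop ℕ∞} {f : X → E →L[ℝ] F →L[ℝ] G} {x : X} (hf : ContDiffAt ℝ n f x) :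
    ContDiffAt ℝ n (fun y => (f y).flip) x :=
  (ContinuousLinearMap.flipₗᵢ ℝ E F G).contDiff.contDiffAt.comp x hf

theorem contDiffAt_lagX {X : Type*} [NormedAddCommGroup X] [NormedSpace ℝ X]
    {A : E → E →L[ℝ] E →L[ℝ] ℝ} {B : E → E →L[ℝ] ℝ} {D : E → ℝ} {y v : X → E} {z₀ : X}
    (hA : ContDiffAt ℝ 2 A (y z₀)) (hB : ContDiffAt ℝ 2 B (y z₀)) (hD : ContDiffAt ℝ 2 D (y z₀))
    (hy : ContDiffAt ℝ 1 y z₀) (hv : ContDiffAt ℝ 1 v z₀) :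
    ContDiffAt ℝ 1 (fun z => lagX A B D (y z) (v z)) z₀ := by
  have hA' : ContDiffAt ℝ 1 (fun z => fderiv ℝ A (y z)) z₀ :=
    (hA.fderiv_right (m := 1) (by norm_num)).comp z₀ hy
  have hB' : ContDiffAt ℝ 1 (fun z => fderiv ℝ B (y z)) z₀ :=
    (hB.fderiv_right (m := 1) (by norm_num)).comp z₀ hy
  have hD' : ContDiffAt ℝ 1 (fun z => fderiv ℝ D (y z)) z₀ :=
    (hD.fderiv_right (m := 1) (by norm_num)).comp z₀ hy
  exact ((contDiffAt_flip ((contDiffAt_flip hA').clm_apply hv)).clm_apply hv).add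
    ((contDiffAt_flip hB').clm_apply hv) |>.add hD'

/-- The linear part of `|v - w|² - σ²` as a function of the velocity `v`. -/
noncomputable def windB (g : E → E →L[ℝ] E →L[ℝ] ℝ) (w : E → E) (y : E) : E →L[ℝ] ℝ :=
  (-2 : ℝ) • g y (w y)

/-- The constant part of `|v - w|² - σ²` as a function of the velocity `v`. -/
noncomputable def windD (g : E → E →L[ℝ] E →L[ℝ] ℝ) (w : E → E) (σ : E → ℝ) (y : E) : ℝ :=
  g y (w y) (w y) - σ y ^ 2

variable {g : E → E →L[ℝ] E →L[ℝ] ℝ} {w : E → E} {σ : E → ℝ} {y₀ : E}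

/-- With these coefficients, the zero set of the Lagrangian consists of the velocities allowed by
wind and own speed. -/
theorem lag_wind {y : E} (hsymm : ∀ v w, g y v w = g y w v) (v : E) :
    lag g (windB g w) (windD g w σ) y v = g y (v - w y) (v - w y) - σ y ^ 2 := by
  simp only [lag, windB, windD, map_sub, sub_apply, smul_apply, smul_eq_mul, hsymm v (w y)]
  ring

theorem lagV_wind (y v : E) : lagV g (windB g w) y v = (2 : ℝ) • g y (v - w y) := by
  ext u
  simp only [lagV, windB, map_sub, smul_sub, add_apply, sub_apply, smul_apply, smul_eq_mul]
  ring

theorem isLagrangianAt_wind (hg : ContDiffAt ℝ 2 g y₀) (hw : ContDiffAt ℝ 2 w y₀)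
    (hσ : ContDiffAt ℝ 2 σ y₀) (hsymm : ∀ᶠ y in 𝓝 y₀, ∀ v w, g y v w = g y w v)
    (hpos : ∀ v, v ≠ 0 → 0 < g y₀ v v) :
    IsLagrangianAt g (windB g w) (windD g w σ) y₀ where
  contDiffAt_A := hg
  contDiffAt_B := (hg.clm_apply hw).const_smul (-2 : ℝ)
  contDiffAt_D := ((hg.clm_apply hw).clm_apply hw).sub (hσ.pow 2)
  symm := hsymm
  pos := hpos

/-- Extremals of the navigation problem exist for all initial positions and velocities. -/
theorem exists_extremal [FiniteDimensional ℝ E] (hg : ContDiffAt ℝ 2 g y₀)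
    (hw : ContDiffAt ℝ 2 w y₀) (hσ : ContDiffAt ℝ 2 σ y₀)
    (hsymm : ∀ᶠ y in 𝓝 y₀, ∀ v w, g y v w = g y w v) (hpos : ∀ v, v ≠ 0 → 0 < g y₀ v v)
    (hσ₀ : 0 < σ y₀) {v₀ : E} (hv₀ : g y₀ (v₀ - w y₀) (v₀ - w y₀) = σ y₀ ^ 2) :
    ∃ (x v : ℝ → E) (p : ℝ → E →L[ℝ] ℝ) (μ : ℝ → ℝ), x 0 = y₀ ∧ v 0 = v₀ ∧ ∀ᶠ t in 𝓝 0,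
      HasDerivAt x (v t) t ∧ p t = μ t • lagV g (windB g w) (x t) (v t) ∧
      HasDerivAt p (μ t • lagX g (windB g w) (windD g w σ) (x t) (v t)) t ∧ 0 < μ t ∧
      ContinuousAt v t ∧ ContinuousAt μ t ∧ lag g (windB g w) (windD g w σ) (x t) (v t) = 0 := by
  have := FiniteDimensional.complete ℝ E
  have hL := isLagrangianAt_wind hg hw hσ hsymm hpos
  set inv : E → (E →L[ℝ] ℝ) →L[ℝ] E := fun y => (g y).inverse with hinv
  -- Solving `p = 2 μ g(v - w)` for `v` gives `vel`. The constraint `|v - w| = σ` then determines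
  -- `μ` as the dual norm of `p` over `2σ`. Position and momentum thus obey an autonomous `C¹`
  -- equation, and the constraint holds along it automatically.
  set mu : E × (E →L[ℝ] ℝ) → ℝ := fun z => Real.sqrt (z.2 (inv z.1 z.2)) / (2 * σ z.1) with hmu
  set vel : E × (E →L[ℝ] ℝ) → E := fun z => w z.1 + (2 * mu z)⁻¹ • inv z.1 z.2 with hvel
  -- The initial momentum is normalized so that the multiplier starts at `1`.
  set p₀ : E →L[ℝ] ℝ := (2 : ℝ) • g y₀ (v₀ - w y₀) with hp₀
  have hinv₀ : inv y₀ p₀ = (2 : ℝ) • (v₀ - w y₀) := by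
    rw [hp₀, map_smul, hinv]
    simp only [(isInvertible_of_pos hpos).inverse_apply_self]
  have hq₀ : p₀ (inv y₀ p₀) = (2 * σ y₀) ^ 2 := by
    rw [hinv₀, hp₀, map_smul, smul_apply, hv₀, smul_eq_mul, smul_eq_mul]
    ring
  have hmu₀ : mu (y₀, p₀) = 1 := by
    simp only [hmu, hq₀]
    rw [Real.sqrt_sq (by positivity), div_self (by positivity)]
  have hvel₀ : vel (y₀, p₀) = v₀ := by
    simp only [hvel, hmu₀, hinv₀, smul_smul]
    norm_num
  have cinv : ContDiffAt ℝ 2 (fun z : E × (E →L[ℝ] ℝ) => inv z.1 z.2) (y₀, p₀) :=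
    ((contDiffAt_inverse hg hpos).comp (y₀, p₀) contDiffAt_fst).clm_apply contDiffAt_snd
  have cq : ContDiffAt ℝ 2 (fun z : E × (E →L[ℝ] ℝ) => z.2 (inv z.1 z.2)) (y₀, p₀) :=
    contDiffAt_snd.clm_apply cinv
  have cσ : ContDiffAt ℝ 2 (fun z : E × (E →L[ℝ] ℝ) => σ z.1) (y₀, p₀) :=
    ContDiffAt.comp (y₀, p₀) (f := Prod.fst) (g := σ) hσ contDiffAt_fst
  have cw : ContDiffAt ℝ 2 (fun z : E × (E →L[ℝ] ℝ) => w z.1) (y₀, p₀) :=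
    ContDiffAt.comp (y₀, p₀) (f := Prod.fst) (g := w) hw contDiffAt_fst
  have cmu : ContDiffAt ℝ 2 mu (y₀, p₀) := by
    refine ContDiffAt.div (cq.sqrt ?_) (contDiffAt_const.mul cσ) ?_
    · simp only [hq₀]
      positivity
    · simp only
      positivity
  have cvel : ContDiffAt ℝ 2 vel (y₀, p₀) := by
    refine cw.add (((contDiffAt_const.mul cmu).inv ?_).smul cinv)
    simp [hmu₀]
  have cX : ContDiffAt ℝ 1 (fun z : E × (E →L[ℝ] ℝ) =>
      lagX g (windB g w) (windD g w σ) z.1 (vel z)) (y₀, p₀) :=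
    contDiffAt_lagX hL.contDiffAt_A hL.contDiffAt_B hL.contDiffAt_D contDiffAt_fst
      (cvel.of_le one_le_two)
  have cY : ContDiffAt ℝ 1 (fun z : E × (E →L[ℝ] ℝ) =>
      (vel z, mu z • lagX g (windB g w) (windD g w σ) z.1 (vel z))) (y₀, p₀) :=
    (cvel.of_le one_le_two).prodMk ((cmu.of_le one_le_two).smul cX)
  obtain ⟨α, hα₀, ε, hε, hα⟩ :=
    cY.exists_forall_mem_closedBall_exists_eq_forall_mem_Ioo_hasDerivAt₀ 0
  obtain ⟨a, ha, hlow⟩ := exists_posDef_lower_bound hg.continuousAt hpos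
  have hposev : ∀ᶠ z : E × (E →L[ℝ] ℝ) in 𝓝 (y₀, p₀), ∀ v, v ≠ 0 → 0 < g z.1 v v :=
    (continuous_fst.tendsto (y₀, p₀)).eventually <| hlow.mono fun y hy v hv =>
      lt_of_lt_of_le (by positivity) (hy v)
  have hsymmev : ∀ᶠ z : E × (E →L[ℝ] ℝ) in 𝓝 (y₀, p₀), ∀ v w, g z.1 v w = g z.1 w v :=
    (continuous_fst.tendsto (y₀, p₀)).eventually hsymm
  have hσev : ∀ᶠ z : E × (E →L[ℝ] ℝ) in 𝓝 (y₀, p₀), 0 < σ z.1 :=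
    cσ.continuousAt.eventually_const_lt hσ₀
  have hqev : ∀ᶠ z : E × (E →L[ℝ] ℝ) in 𝓝 (y₀, p₀), 0 < z.2 (inv z.1 z.2) :=
    cq.continuousAt.eventually_const_lt (by simp only [hq₀]; positivity)
  have hcvel : ∀ᶠ z in 𝓝 (y₀, p₀), ContinuousAt vel z :=
    (cvel.eventually (by simp)).mono fun z hz => hz.continuousAt
  have hcmu : ∀ᶠ z in 𝓝 (y₀, p₀), ContinuousAt mu z :=
    (cmu.eventually (by simp)).mono fun z hz => hz.continuousAt
  have hαc : Tendsto α (𝓝 0) (𝓝 (y₀, p₀)) := by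
    rw [← hα₀]
    exact (hα 0 (by simpa using hε)).continuousAt
  refine ⟨fun t => (α t).1, fun t => vel (α t), fun t => (α t).2, fun t => mu (α t),
    by simp [hα₀], by simp [hα₀, hvel₀], ?_⟩
  filter_upwards [Ioo_mem_nhds (by linarith : (0 : ℝ) - ε < 0) (by linarith : (0 : ℝ) < 0 + ε),
    hαc.eventually hposev, hαc.eventually hsymmev, hαc.eventually hσev, hαc.eventually hqev,
    hαc.eventually hcvel, hαc.eventually hcmu] with t ht h1 h2 h3 h4 h5 h6
  have hd := hα t ht
  have hmupos : 0 < mu (α t) := div_pos (Real.sqrt_pos.2 h4) (by positivity)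
  have hvw : vel (α t) - w (α t).1 = (2 * mu (α t))⁻¹ • inv (α t).1 (α t).2 := by
    simp [hvel]
  have hgi : g (α t).1 (inv (α t).1 (α t).2) = (α t).2 :=
    (isInvertible_of_pos h1).self_apply_inverse _
  refine ⟨hd.fst, ?_, hd.snd, hmupos, h5.comp hd.continuousAt,
    h6.comp hd.continuousAt, ?_⟩
  · rw [lagV_wind, hvw, map_smul, hgi, smul_smul, smul_smul]
    have : mu (α t) * (2 * (2 * mu (α t))⁻¹) = 1 := by field_simp
    rw [← mul_assoc] at this
    rw [mul_assoc, ← mul_assoc, this, one_smul]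
  · rw [lag_wind h2, hvw, map_smul, map_smul, smul_apply, hgi, smul_eq_mul, smul_eq_mul]
    have e : (2 * mu (α t)) ^ 2 * σ (α t).1 ^ 2 = (α t).2 (inv (α t).1 (α t).2) := by
      have : 2 * mu (α t) * σ (α t).1 = Real.sqrt ((α t).2 (inv (α t).1 (α t).2)) := by
        simp only [hmu]
        field_simp
      rw [← mul_pow, this, Real.sq_sqrt h4.le]
    rw [← e]
    field_simp
    ring

end Existence

/-! ### The geodesic flow and the two-point boundary value problem -/

section Flow

variable {E : Type*} [NormedAddCommGroup E] [NormedSpace ℝ E]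

/-- A `C¹` vector field has a local flow which is Lipschitz in the initial point and stays in a
given neighbourhood. -/
theorem exists_lipschitz_flow [CompleteSpace E] {f : E → E} {z₀ : E} (hf : ContDiffAt ℝ 1 f z₀)
    {N : Set E} (hN : N ∈ 𝓝 z₀) :
    ∃ r > (0 : ℝ), ∃ ε > (0 : ℝ), ∃ (L : ℝ≥0) (α : E → ℝ → E), ∀ z ∈ Metric.closedBall z₀ r,
      α z 0 = z ∧ ∀ t ∈ Icc (-ε) ε, HasDerivAt (α z) (f (α z t)) t ∧ α z t ∈ N ∧
        ∀ z' ∈ Metric.closedBall z₀ r, ‖α z t - α z' t‖ ≤ L * ‖z - z'‖ := by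
  obtain ⟨ε, hε, a, r, _, _, hr, hpl⟩ := IsPicardLindelof.of_contDiffAt_one hf
  obtain ⟨α, hα, L, hLip⟩ :=
    (hpl 0).exists_forall_mem_closedBall_eq_hasDerivWithinAt_lipschitzOnWith
  simp only [zero_sub, zero_add] at hα hLip
  obtain ⟨δ, hδ, hδN⟩ := Metric.mem_nhds_iff.1 hN
  have hz₀ : z₀ ∈ Metric.closedBall z₀ (r : ℝ) := Metric.mem_closedBall_self r.2
  have hderiv : ∀ z ∈ Metric.closedBall z₀ (r : ℝ), ∀ t ∈ Ioo (-ε) ε,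
      HasDerivAt (α z) (f (α z t)) t := fun z hz t ht =>
    ((hα z hz).2 t (Ioo_subset_Icc_self ht)).hasDerivAt (Icc_mem_nhds ht.1 ht.2)
  have hc : ∀ᶠ t in 𝓝 (0 : ℝ), ‖α z₀ t - z₀‖ < δ / 2 := by
    have := (hderiv z₀ hz₀ 0 (by simpa using hε)).continuousAt
    have h' := eventually_norm_sub_lt this (half_pos hδ)
    rwa [(hα z₀ hz₀).1] at h'
  obtain ⟨ε', hε', hball⟩ := Metric.eventually_nhds_iff.1 hc
  have hr' : (0 : ℝ) < r := hr
  -- Staying in the `δ`-ball costs `δ / 2` for the motion of the central orbit and `δ / 2` for the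
  -- Lipschitz dependence on the initial point.
  refine ⟨min r (δ / (2 * (L + 1))), by positivity, min (ε / 2) (ε' / 2), by positivity, L, α,
    fun z hz => ?_⟩
  have hsub : ∀ z ∈ Metric.closedBall z₀ (min (r : ℝ) (δ / (2 * (L + 1)))),
      z ∈ Metric.closedBall z₀ (r : ℝ) := fun z hz =>
    Metric.closedBall_subset_closedBall (min_le_left _ _) hz
  refine ⟨(hα z (hsub z hz)).1, fun t ht => ?_⟩
  have ht1 : |t| ≤ ε / 2 := (abs_le.2 ht).trans (min_le_left _ _)
  have ht2 : |t| ≤ ε' / 2 := (abs_le.2 ht).trans (min_le_right _ _)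
  have htε : t ∈ Ioo (-ε) ε := abs_lt.1 (by linarith)
  have hl : ∀ z ∈ Metric.closedBall z₀ (r : ℝ), ∀ z' ∈ Metric.closedBall z₀ (r : ℝ),
      ‖α z t - α z' t‖ ≤ L * ‖z - z'‖ := fun z hz z' hz' =>
    (hLip t (Ioo_subset_Icc_self htε)).norm_sub_le hz hz'
  refine ⟨hderiv z (hsub z hz) t htε, hδN ?_, fun z' hz' => hl z (hsub z hz) z' (hsub z' hz')⟩
  have h1 := hl z (hsub z hz) z₀ hz₀
  have h2 : ‖α z₀ t - z₀‖ < δ / 2 := hball (by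
    rw [Real.dist_eq, sub_zero]
    linarith)
  have h3 : ‖z - z₀‖ ≤ δ / (2 * (L + 1)) :=
    (mem_closedBall_iff_norm.1 hz).trans (min_le_right _ _)
  have h4 : L * ‖z - z₀‖ ≤ δ / 2 := by
    calc L * ‖z - z₀‖ ≤ (L + 1) * (δ / (2 * (L + 1))) := by
          gcongr
          linarith
      _ = δ / 2 := by field_simp
  rw [mem_ball_iff_norm]
  calc ‖α z t - z₀‖ = ‖(α z t - α z₀ t) + (α z₀ t - z₀)‖ := by congr 1; abel
    _ ≤ ‖α z t - α z₀ t‖ + ‖α z₀ t - z₀‖ := norm_add_le _ _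
    _ < δ := by linarith

/-- The acceleration of the geodesics of the metric `g`. -/
noncomputable def geodesicAcc (g : E → E →L[ℝ] E →L[ℝ] ℝ) (y v : E) : E :=
  (g y).inverse ((1 / 2 : ℝ) • lagX g 0 0 y v - fderiv ℝ g y v v)

variable {g : E → E →L[ℝ] E →L[ℝ] ℝ} {y₀ : E}

theorem lagX_metric_apply (y v ξ : E) : lagX g 0 0 y v ξ = fderiv ℝ g y ξ v v := by
  rw [lagX_apply, fderiv_zero, fderiv_zero]
  simp

theorem lagV_metric (y v : E) : lagV g 0 y v = (2 : ℝ) • g y v := by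
  simp [lagV]

theorem lag_metric (y v : E) : lag g 0 0 y v = g y v v := by
  simp [lag]

theorem lagX_metric_smul (y v : E) (c : ℝ) : lagX g 0 0 y (c • v) = c ^ 2 • lagX g 0 0 y v := by
  ext ξ
  simp only [lagX_metric_apply, map_smul, smul_apply, smul_eq_mul]
  ring

/-- Quadratic homogeneity in the velocity is what allows a geodesic to be run at any constant
multiple of its speed. -/
theorem geodesicAcc_smul (y v : E) (c : ℝ) :
    geodesicAcc g y (c • v) = c ^ 2 • geodesicAcc g y v := by
  rw [geodesicAcc, geodesicAcc, lagX_metric_smul, ← map_smul]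
  congr 1
  simp only [map_smul, smul_apply, smul_sub, smul_smul]
  congr 2
  · ring
  · ring

theorem apply_geodesicAcc [FiniteDimensional ℝ E] {y : E} (hpos : ∀ v, v ≠ 0 → 0 < g y v v)
    (v : E) : g y (geodesicAcc g y v) = (1 / 2 : ℝ) • lagX g 0 0 y v - fderiv ℝ g y v v :=
  (isInvertible_of_pos hpos).self_apply_inverse _

/-- Solutions of the geodesic equation are extremals of the energy. -/
theorem hasDerivAt_momentum {x v : ℝ → E} {a : E} {t : ℝ} (hg : DifferentiableAt ℝ g (x t))
    (ha : g (x t) a = (1 / 2 : ℝ) • lagX g 0 0 (x t) (v t) - fderiv ℝ g (x t) (v t) (v t))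
    (hx : HasDerivAt x (v t) t) (hv : HasDerivAt v a t) :
    HasDerivAt (fun t => lagV g 0 (x t) (v t)) (lagX g 0 0 (x t) (v t)) t := by
  have h1 : HasDerivAt (fun t => g (x t)) (fderiv ℝ g (x t) (v t)) t :=
    hg.hasFDerivAt.comp_hasDerivAt t hx
  have h2 := (h1.clm_apply hv).const_smul (2 : ℝ)
  simp only [lagV_metric]
  refine h2.congr_deriv ?_
  rw [ha, smul_add, smul_sub, smul_smul]
  norm_num

/-- Geodesics have constant speed. -/
theorem hasDerivAt_energy {x v : ℝ → E} {a : E} {t : ℝ} (hg : DifferentiableAt ℝ g (x t))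
    (hsymm : ∀ v w, g (x t) v w = g (x t) w v)
    (ha : g (x t) a = (1 / 2 : ℝ) • lagX g 0 0 (x t) (v t) - fderiv ℝ g (x t) (v t) (v t))
    (hx : HasDerivAt x (v t) t) (hv : HasDerivAt v a t) :
    HasDerivAt (fun t => g (x t) (v t) (v t)) 0 t := by
  have h1 : HasDerivAt (fun t => g (x t)) (fderiv ℝ g (x t) (v t)) t :=
    hg.hasFDerivAt.comp_hasDerivAt t hx
  have h2 := (h1.clm_apply hv).clm_apply hv
  refine h2.congr_deriv ?_
  rw [add_apply, hsymm (v t) a, ha]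
  simp only [sub_apply, smul_apply, smul_eq_mul, lagX_metric_apply]
  ring

theorem contDiffAt_geodesicAcc [FiniteDimensional ℝ E] (hg : ContDiffAt ℝ 2 g y₀)
    (hpos : ∀ v, v ≠ 0 → 0 < g y₀ v v) (v₀ : E) :
    ContDiffAt ℝ 1 (fun z : E × E => geodesicAcc g z.1 z.2) (y₀, v₀) := by
  have h1 : ContDiffAt ℝ 1 (fun z : E × E => lagX g 0 0 z.1 z.2) (y₀, v₀) :=
    contDiffAt_lagX (y := Prod.fst) (v := Prod.snd) (z₀ := (y₀, v₀)) hg contDiffAt_const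
      contDiffAt_const contDiffAt_fst contDiffAt_snd
  have h2 : ContDiffAt ℝ 1 (fun z : E × E => fderiv ℝ g z.1) (y₀, v₀) :=
    ContDiffAt.comp (f := Prod.fst) (g := fderiv ℝ g) (y₀, v₀)
      (hg.fderiv_right (m := 1) (by norm_num)) contDiffAt_fst
  have h3 : ContDiffAt ℝ 1 (fun z : E × E => (g z.1).inverse) (y₀, v₀) :=
    ContDiffAt.comp (f := Prod.fst) (g := fun y => (g y).inverse) (y₀, v₀)
      (contDiffAt_inverse (hg.of_le one_le_two) hpos) contDiffAt_fst
  exact h3.clm_apply ((h1.const_smul (1 / 2 : ℝ)).sub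
    ((h2.clm_apply contDiffAt_snd).clm_apply contDiffAt_snd))

/-- Nearby points are joined by a geodesic in any given time, with velocity controlled by the
average velocity. -/
theorem exists_geodesic_between [FiniteDimensional ℝ E] [Nontrivial E] (hg : ContDiffAt ℝ 2 g y₀)
    (hsymm : ∀ᶠ y in 𝓝 y₀, ∀ v w, g y v w = g y w v) (hpos : ∀ v, v ≠ 0 → 0 < g y₀ v v) :
    ∃ Λ > 0, ∀ N ∈ 𝓝 y₀, ∃ ρ > 0, ∀ z₁ ∈ Metric.ball y₀ ρ, ∀ z₂ ∈ Metric.ball y₀ ρ, ∀ t₁ t₂ : ℝ,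
      t₁ < t₂ →
      ∃ (x v : ℝ → E) (κ : ℝ), x t₁ = z₁ ∧ x t₂ = z₂ ∧ ∀ t ∈ Icc t₁ t₂,
        (∀ᶠ r in 𝓝 t, HasDerivAt x (v r) r ∧ HasDerivAt v (geodesicAcc g (x r) (v r)) r) ∧
        x t ∈ N ∧ g (x t) (v t) (v t) = κ ∧ ‖v t‖ * (t₂ - t₁) ≤ Λ * ‖z₂ - z₁‖ := by
  have := FiniteDimensional.complete ℝ E
  obtain ⟨a, ha, hlow⟩ := exists_posDef_lower_bound hg.continuousAt hpos
  have hdiff : ∀ᶠ y in 𝓝 y₀, DifferentiableAt ℝ g y :=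
    (hg.eventually (by simp)).mono fun y hy => hy.differentiableAt (by norm_num)
  have hbd : ∀ᶠ y in 𝓝 y₀, ‖g y‖ < ‖g y₀‖ + 1 := by
    have h : ContinuousAt (fun y => ‖g y‖) y₀ := hg.continuousAt.norm
    exact h.eventually_lt_const (by simp)
  set b : ℝ := ‖g y₀‖ + 1 with hb
  have hbpos : 0 < b := by positivity
  -- Conservation of energy between the bounds `a` and `b` of the metric gives `√(b / a)`. The `2`
  -- comes from inverting a map that is within `1 / 2` of the identity.
  refine ⟨2 * Real.sqrt (b / a), by positivity, fun N hN => ?_⟩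
  have hgood := (hsymm.and hlow).and ((hdiff.and hbd).and hN)
  have hacc := contDiffAt_geodesicAcc hg hpos 0
  obtain ⟨K, s, hs, hK⟩ := hacc.exists_lipschitzOnWith
  have cX : ContDiffAt ℝ 1 (fun z : E × E => (z.2, geodesicAcc g z.1 z.2)) (y₀, 0) :=
    contDiffAt_snd.prodMk hacc
  have hnhds : s ∩ {z : E × E | z.1 ∈ {y | ((∀ v w, g y v w = g y w v) ∧
      ∀ v, a * ‖v‖ ^ 2 ≤ g y v v) ∧ (DifferentiableAt ℝ g y ∧ ‖g y‖ < b) ∧ y ∈ N}} ∈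
      𝓝 (y₀, (0 : E)) :=
    inter_mem hs ((continuous_fst.tendsto (y₀, (0 : E))).eventually hgood)
  obtain ⟨r, hr, ε, hε, L, α, hα⟩ := exists_lipschitz_flow cX hnhds
  have hmem : ∀ z₁ u : E, ‖z₁ - y₀‖ ≤ r → ‖u‖ ≤ r → (z₁, u) ∈ Metric.closedBall (y₀, (0 : E)) r :=
    fun z₁ u h1 h2 => by
      rw [mem_closedBall_iff_norm, Prod.norm_def]
      simpa using ⟨h1, h2⟩
  have h0ε : (0 : ℝ) ∈ Icc (-ε) ε := ⟨by linarith, hε.le⟩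
  have hX : ∀ z ∈ Metric.closedBall (y₀, (0 : E)) r, ∀ t ∈ Icc (-ε) ε,
      HasDerivAt (fun t => (α z t).1) (α z t).2 t := fun z hz t ht => ((hα z hz).2 t ht).1.fst
  have hV : ∀ z ∈ Metric.closedBall (y₀, (0 : E)) r, ∀ t ∈ Icc (-ε) ε,
      HasDerivAt (fun t => (α z t).2) (geodesicAcc g (α z t).1 (α z t).2) t :=
    fun z hz t ht => ((hα z hz).2 t ht).1.snd
  have hen : ∀ z ∈ Metric.closedBall (y₀, (0 : E)) r, ∀ t ∈ Icc (-ε) ε,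
      g (α z t).1 (α z t).2 (α z t).2 = g z.1 z.2 z.2 := by
    intro z hz t ht
    have hd : ∀ t ∈ Icc (-ε) ε,
        HasDerivAt (fun t => g (α z t).1 (α z t).2 (α z t).2) 0 t := by
      intro t ht
      obtain ⟨-, ⟨-, ⟨h1, h2⟩, ⟨h3, -⟩, -⟩, -⟩ := (hα z hz).2 t ht
      refine hasDerivAt_energy (x := fun t => (α z t).1) (v := fun t => (α z t).2)
        h3 h1 (apply_geodesicAcc (fun v hv => ?_) _) (hX z hz t ht) (hV z hz t ht)
      exact lt_of_lt_of_le (by positivity) (h2 v)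
    have := (convex_Icc (-ε) ε).norm_image_sub_le_of_norm_hasDerivWithin_le (C := 0)
      (fun t ht => (hd t ht).hasDerivWithinAt) (fun t ht => by simp)
      h0ε ht
    rw [zero_mul, norm_le_zero_iff, sub_eq_zero] at this
    rw [this, (hα z hz).1]
  have hvel : ∀ z ∈ Metric.closedBall (y₀, (0 : E)) r, ∀ t ∈ Icc (-ε) ε,
      ‖(α z t).2‖ ≤ Real.sqrt (b / a) * ‖z.2‖ := by
    intro z hz t ht
    obtain ⟨-, ⟨-, ⟨-, h2⟩, -⟩, -⟩ := (hα z hz).2 t ht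
    obtain ⟨-, ⟨-, -, ⟨-, h4⟩, -⟩, -⟩ := (hα z hz).2 0 h0ε
    rw [(hα z hz).1] at h4
    have h5 := h2 (α z t).2
    rw [hen z hz t ht] at h5
    have h6 : g z.1 z.2 z.2 ≤ b * ‖z.2‖ * ‖z.2‖ :=
      (le_abs_self _).trans ((abs_form_apply_le _ _ _).trans (by gcongr))
    refine abs_le_of_sq_le_sq' ?_ (by positivity) |>.2
    rw [mul_pow, Real.sq_sqrt (by positivity), div_mul_eq_mul_div, le_div_iff₀ ha]
    linarith
  -- Up to time `τ`, the difference of the velocities of two geodesics from the same point changes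
  -- by at most half of its initial value, since `K L τ ≤ 1 / 2`.
  set τ : ℝ := min (ε / 2) (1 / (2 * (K * L + 1))) with hτ
  have hτpos : 0 < τ := by positivity
  have hτε : τ ≤ ε / 2 := min_le_left _ _
  have hτKL : K * L * τ ≤ 1 / 2 := by
    calc K * L * τ ≤ (K * L + 1) * (1 / (2 * (K * L + 1))) := by
          gcongr
          · linarith
          · exact min_le_right _ _
      _ = 1 / 2 := by field_simp
  have hsub : ∀ t ∈ Icc 0 τ, t ∈ Icc (-ε) ε := fun t ht =>
    ⟨by linarith [ht.1], by linarith [ht.2]⟩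
  have hsurj : ∀ z₁ : E, ‖z₁ - y₀‖ ≤ r → ∀ e ∈ Icc 0 r,
      SurjOn (fun u => τ⁻¹ • (α (z₁, u) τ).1) (Metric.closedBall 0 e)
        (Metric.closedBall (τ⁻¹ • z₁) (1 / 2 * e)) := by
    intro z₁ hz₁ e he
    -- The rescaled exponential map differs from the identity by a map with Lipschitz constant `1 /
    -- 2`. The quantitative inverse function theorem then makes it onto a ball of half the radius
    -- around its value at `0`, which is `τ⁻¹ • z₁` since zero velocity means rest.
    have happ : ApproximatesLinearOn (fun u => τ⁻¹ • (α (z₁, u) τ).1)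
        ((ContinuousLinearEquiv.refl ℝ E : E ≃L[ℝ] E) : E →L[ℝ] E) (Metric.closedBall 0 e)
        (1 / 2 : ℝ≥0) := by
      rw [ApproximatesLinearOn.approximatesLinearOn_iff_lipschitzOnWith]
      refine LipschitzOnWith.of_dist_le_mul fun u hu u' hu' => ?_
      have hzu := hmem z₁ u hz₁ ((mem_closedBall_zero_iff.1 hu).trans he.2)
      have hzu' := hmem z₁ u' hz₁ ((mem_closedBall_zero_iff.1 hu').trans he.2)
      have hnorm : ‖(z₁, u) - (z₁, u')‖ = ‖u - u'‖ := by simp [Prod.norm_def]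
      have hv' : ∀ t ∈ Icc (0 : ℝ) τ,
          ‖(α (z₁, u) t).2 - (α (z₁, u') t).2 - (u - u')‖ ≤ (1 / 2) * ‖u - u'‖ := by
        intro t ht
        have h0 := (convex_Icc (0 : ℝ) τ).norm_image_sub_le_of_norm_hasDerivWithin_le
          (f := fun t => (α (z₁, u) t).2 - (α (z₁, u') t).2) (C := K * (L * ‖u - u'‖))
          (fun s hs => ((hV _ hzu s (hsub s hs)).sub
            (hV _ hzu' s (hsub s hs))).hasDerivWithinAt)
          (fun s hs => by
            have hs' := hsub s hs
            refine (hK.norm_sub_le ((hα _ hzu).2 s hs').2.1.1 ((hα _ hzu').2 s hs').2.1.1).trans ?_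
            gcongr
            rw [← hnorm]
            exact ((hα _ hzu).2 s hs').2.2 _ hzu')
          (left_mem_Icc.2 hτpos.le) ht
        simp only [(hα _ hzu).1, (hα _ hzu').1, sub_zero] at h0
        refine h0.trans ?_
        rw [Real.norm_eq_abs, abs_of_nonneg ht.1]
        calc K * (L * ‖u - u'‖) * t ≤ K * (L * ‖u - u'‖) * τ := by
              gcongr
              exact ht.2
          _ = K * L * τ * ‖u - u'‖ := by ring
          _ ≤ _ := by gcongr
      have hx' := (convex_Icc (0 : ℝ) τ).norm_image_sub_le_of_norm_hasDerivWithin_le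
          (f := fun t => (α (z₁, u) t).1 - (α (z₁, u') t).1 - t • (u - u'))
          (C := (1 / 2) * ‖u - u'‖)
          (fun s hs => (((hX _ hzu s (hsub s hs)).sub
            (hX _ hzu' s (hsub s hs))).sub
              ((hasDerivAt_id s).smul_const (u - u'))).hasDerivWithinAt)
          (fun s hs => by simpa using hv' s hs)
          (left_mem_Icc.2 hτpos.le) (right_mem_Icc.2 hτpos.le)
      simp only [(hα _ hzu).1, (hα _ hzu').1, sub_self, zero_smul, sub_zero] at hx'
      rw [dist_eq_norm, dist_eq_norm]
      simp only [Pi.sub_apply, ContinuousLinearEquiv.coe_coe, ContinuousLinearEquiv.refl_apply]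
      have e1 : τ⁻¹ • (α (z₁, u) τ).1 - u - (τ⁻¹ • (α (z₁, u') τ).1 - u') =
          τ⁻¹ • ((α (z₁, u) τ).1 - (α (z₁, u') τ).1 - τ • (u - u')) := by
        simp only [smul_sub, smul_smul, inv_mul_cancel₀ hτpos.ne', one_smul]
        abel
      rw [e1, norm_smul, norm_inv, Real.norm_eq_abs, abs_of_pos hτpos, inv_mul_le_iff₀ hτpos]
      refine hx'.trans (le_of_eq ?_)
      rw [Real.norm_eq_abs, abs_of_pos hτpos]
      simp
      ring
    have h := happ.surjOn_closedBall_of_nonlinearRightInverse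
      (ContinuousLinearEquiv.refl ℝ E).toNonlinearRightInverse he.1 (Subset.refl _)
    have hz0 := hmem z₁ 0 hz₁ (by simpa using hr.le)
    have hstay : (α (z₁, 0) τ).1 = z₁ := by
      have := (convex_Icc (-ε) ε).norm_image_sub_le_of_norm_hasDerivWithin_le (C := 0)
        (fun t ht => (hX _ hz0 t ht).hasDerivWithinAt)
        (fun t ht => by simpa using hvel _ hz0 t ht)
        h0ε (hsub τ ⟨hτpos.le, le_rfl⟩)
      rw [zero_mul, norm_le_zero_iff, sub_eq_zero] at this
      rw [this, (hα _ hz0).1]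
    have hn : (((ContinuousLinearEquiv.refl ℝ E).toNonlinearRightInverse.nnnorm : ℝ≥0) : ℝ)
        = 1 := by
      change ‖((ContinuousLinearEquiv.refl ℝ E).symm : E →L[ℝ] E)‖ = 1
      exact ContinuousLinearMap.norm_id
    rw [hn] at h
    simp only [hstay] at h
    convert h using 2
    norm_num
  -- With this radius `‖z₂ - z₁‖ ≤ r τ / 2`, so initial velocities of norm at most `2 ‖z₂ - z₁‖ / τ
  -- ≤ r` suffice to reach `z₂`.
  refine ⟨min r (r * τ / 4), by positivity,
    fun z₁ hz₁ z₂ hz₂ t₁ t₂ ht₁₂ => ?_⟩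
  rw [mem_ball_iff_norm, lt_min_iff] at hz₁ hz₂
  have hdist : ‖z₂ - z₁‖ ≤ r * τ / 2 := by
    calc ‖z₂ - z₁‖ = ‖(z₂ - y₀) - (z₁ - y₀)‖ := by congr 1; abel
      _ ≤ ‖z₂ - y₀‖ + ‖z₁ - y₀‖ := norm_sub_le _ _
      _ ≤ r * τ / 2 := by linarith
  have he : 2 * ‖z₂ - z₁‖ / τ ∈ Icc 0 r :=
    ⟨by positivity, by rw [div_le_iff₀ hτpos]; linarith⟩
  obtain ⟨u, hu, huz⟩ := hsurj z₁ hz₁.1.le _ he (a := τ⁻¹ • z₂) (by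
    rw [mem_closedBall_iff_norm, ← smul_sub, norm_smul, norm_inv, Real.norm_eq_abs,
      abs_of_pos hτpos]
    apply le_of_eq
    field_simp)
  rw [mem_closedBall_zero_iff] at hu
  have hz := hmem z₁ u hz₁.1.le (hu.trans he.2)
  have huz' : (α (z₁, u) τ).1 = z₂ := smul_right_injective E (inv_ne_zero hτpos.ne') huz
  -- The geodesic found takes time `τ`; running it at `c` times its speed makes it take time `t₂ -
  -- t₁`.
  set c : ℝ := τ / (t₂ - t₁) with hc
  have hT : 0 < t₂ - t₁ := sub_pos.2 ht₁₂
  have hcpos : 0 < c := by positivity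
  have hin : ∀ t ∈ Icc t₁ t₂, c * (t - t₁) ∈ Icc 0 τ := fun t ht => by
    refine ⟨mul_nonneg hcpos.le (sub_nonneg.2 ht.1), ?_⟩
    calc c * (t - t₁) ≤ c * (t₂ - t₁) := by
          gcongr
          exact ht.2
      _ = τ := by rw [hc]; field_simp
  have hlin : ∀ t, HasDerivAt (fun t => c * (t - t₁)) c t := fun t => by
    simpa using ((hasDerivAt_id t).sub_const t₁).const_mul c
  refine ⟨fun t => (α (z₁, u) (c * (t - t₁))).1, fun t => c • (α (z₁, u) (c * (t - t₁))).2,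
    c ^ 2 * g z₁ u u, ?_, ?_, fun t ht => ⟨?_, ?_, ?_, ?_⟩⟩
  · simp [(hα _ hz).1]
  · have : c * (t₂ - t₁) = τ := by rw [hc]; field_simp
    simp only [this, huz']
  · have hnear : ∀ᶠ r in 𝓝 t, c * (r - t₁) ∈ Icc (-ε) ε :=
      (hlin t).continuousAt.eventually (Icc_mem_nhds (by linarith [(hin t ht).1])
        (by linarith [(hin t ht).2]))
    filter_upwards [hnear] with r hr
    refine ⟨HasDerivAt.scomp (g₁ := fun t => (α (z₁, u) t).1) r (hX _ hz _ hr) (hlin r), ?_⟩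
    rw [geodesicAcc_smul, sq, mul_smul]
    exact (HasDerivAt.scomp (g₁ := fun t => (α (z₁, u) t).2) r (hV _ hz _ hr)
      (hlin r)).const_smul c
  · exact ((hα _ hz).2 _ (hsub _ (hin t ht))).2.1.2.2.2
  · simp only [map_smul, smul_apply, smul_eq_mul]
    rw [hen _ hz _ (hsub _ (hin t ht))]
    ring
  · simp only
    rw [norm_smul, Real.norm_eq_abs, abs_of_pos hcpos]
    have h1 := hvel _ hz _ (hsub _ (hin t ht))
    calc c * ‖(α (z₁, u) (c * (t - t₁))).2‖ * (t₂ - t₁)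
        = τ * ‖(α (z₁, u) (c * (t - t₁))).2‖ := by rw [hc]; field_simp
      _ ≤ τ * (Real.sqrt (b / a) * ‖u‖) := by gcongr
      _ ≤ τ * (Real.sqrt (b / a) * (2 * ‖z₂ - z₁‖ / τ)) := by gcongr
      _ = 2 * Real.sqrt (b / a) * ‖z₂ - z₁‖ := by field_simp

end Flow

/-! ### Metric, wind and own speed in a chart -/

section Charts

variable {E : Type*} [NormedAddCommGroup E] [NormedSpace ℝ E]
  {M : Type*} [TopologicalSpace M] [ChartedSpace E M]

/-- The derivative of a chart, with values in the model space. -/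
noncomputable def dchart (φ : OpenPartialHomeomorph M E) (x : M) :
    TangentSpace 𝓘(ℝ, E) x →L[ℝ] E :=
  mfderiv 𝓘(ℝ, E) 𝓘(ℝ, E) φ x

/-- The derivative of the inverse of a chart, defined on the model space. -/
noncomputable def dsymm (φ : OpenPartialHomeomorph M E) (y : E) :
    E →L[ℝ] TangentSpace 𝓘(ℝ, E) (φ.symm y) :=
  mfderiv 𝓘(ℝ, E) 𝓘(ℝ, E) φ.symm y

/-- The vector field `W` in the chart `φ`. -/
noncomputable def chartWind (W : ∀ x : M, TangentSpace 𝓘(ℝ, E) x)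
    (φ : OpenPartialHomeomorph M E) (y : E) : E :=
  dchart φ (φ.symm y) (W (φ.symm y))

theorem chartWind_eq {φ : OpenPartialHomeomorph M E} (W : ∀ x : M, TangentSpace 𝓘(ℝ, E) x) {x : M}
    (hx : x ∈ φ.source) : chartWind W φ (φ x) = dchart φ x (W x) := by
  rw [chartWind, φ.left_inv hx]

variable [IsManifold 𝓘(ℝ, E) ∞ M]

/-- The metric in the chart `φ`, as a field of bilinear forms. -/
noncomputable def chartForm (h : Metric E M) (φ : OpenPartialHomeomorph M E) (y : E) :
    E →L[ℝ] E →L[ℝ] ℝ :=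
  let g : E →L[ℝ] E →L[ℝ] ℝ := h.inner (φ.symm y)
  let d : E →L[ℝ] E := dsymm φ y
  g.bilinearComp d d

theorem chartForm_apply (h : Metric E M) (φ : OpenPartialHomeomorph M E) (y v w : E) :
    chartForm h φ y v w = h.inner (φ.symm y) (dsymm φ y v) (dsymm φ y w) := rfl

theorem chartMetric_eq (h : Metric E M) (φ : OpenPartialHomeomorph M E) (y v w : E) :
    chartMetric h φ y v w = chartForm h φ y v w := rfl

variable {φ : OpenPartialHomeomorph M E}

theorem contMDiffOn_chart_symm (hφ : φ ∈ atlas E M) :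
    ContMDiffOn 𝓘(ℝ, E) 𝓘(ℝ, E) ∞ φ.symm φ.target :=
  contMDiffOn_symm_of_mem_maximalAtlas (IsManifold.subset_maximalAtlas hφ)

theorem contMDiffOn_chart (hφ : φ ∈ atlas E M) :
    ContMDiffOn 𝓘(ℝ, E) 𝓘(ℝ, E) ∞ φ φ.source :=
  contMDiffOn_of_mem_maximalAtlas (IsManifold.subset_maximalAtlas hφ)

theorem mdifferentiable_chart_of_mem_atlas (hφ : φ ∈ atlas E M) :
    φ.MDifferentiable 𝓘(ℝ, E) 𝓘(ℝ, E) :=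
  mdifferentiable_of_mem_atlas hφ

theorem dchart_dsymm (hφ : φ ∈ atlas E M) {y : E} (hy : y ∈ φ.target) (v : E) :
    dchart φ (φ.symm y) (dsymm φ y v) = v :=
  DFunLike.congr_fun ((mdifferentiable_chart_of_mem_atlas hφ).comp_symm_deriv hy) v

theorem dsymm_dchart (hφ : φ ∈ atlas E M) {y : E} (hy : y ∈ φ.target)
    (u : TangentSpace 𝓘(ℝ, E) (φ.symm y)) : dsymm φ y (dchart φ (φ.symm y) u) = u := by
  have h1 := (mdifferentiable_chart_of_mem_atlas hφ).symm_comp_deriv (φ.map_target hy)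
  -- The tangent spaces depend on the base point, so `φ (φ.symm y)` is replaced by `y` through a
  -- general `y'` with values read in `E`.
  have h2 : ∀ y' : E, y' = y → ∀ a : E,
      (mfderiv 𝓘(ℝ, E) 𝓘(ℝ, E) φ.symm y' a : E) = dsymm φ y a := by
    rintro y' rfl a
    rfl
  exact (h2 _ (φ.right_inv hy) _).symm.trans (DFunLike.congr_fun h1 u)

/-- The metric evaluated in a chart. -/
theorem inner_eq_chartForm (h : Metric E M) (hφ : φ ∈ atlas E M) {x : M} (hx : x ∈ φ.source)
    (u v : TangentSpace 𝓘(ℝ, E) x) :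
    h.inner x u v = chartForm h φ (φ x) (dchart φ x u) (dchart φ x v) := by
  obtain ⟨y, hy, rfl⟩ : ∃ y ∈ φ.target, φ.symm y = x := ⟨φ x, φ.map_source hx, φ.left_inv hx⟩
  rw [φ.right_inv hy, chartForm_apply, dsymm_dchart hφ hy, dsymm_dchart hφ hy]

theorem contMDiffOn_dsymm (hφ : φ ∈ atlas E M) (v : E) :
    ContMDiffOn 𝓘(ℝ, E) 𝓘(ℝ, E).tangent ∞ (fun y : E =>
      (⟨φ.symm y, dsymm φ y v⟩ : TangentBundle 𝓘(ℝ, E) M)) φ.target := by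
  have h1 := (contMDiffOn_chart_symm hφ).contMDiffOn_tangentMapWithin (m := ∞) (by simp)
    φ.open_target.uniqueMDiffOn
  have h2 : ContMDiffOn 𝓘(ℝ, E) 𝓘(ℝ, E).tangent ∞
      (fun y : E => (⟨y, v⟩ : TangentBundle 𝓘(ℝ, E) E)) φ.target :=
    contMDiffOn_vectorSpace_iff_contDiffOn.2 contDiffOn_const
  refine (h1.comp h2 fun y hy => hy).congr fun y hy => ?_
  simp only [Function.comp_apply, tangentMapWithin]
  rw [mfderivWithin_of_isOpen φ.open_target hy]
  rfl

theorem contDiffOn_chartForm [FiniteDimensional ℝ E] (h : Metric E M) (hφ : φ ∈ atlas E M) :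
    ContDiffOn ℝ ∞ (chartForm h φ) φ.target := by
  rw [contDiffOn_clm_apply]
  intro v
  rw [contDiffOn_clm_apply]
  intro w
  have h1 : ContMDiffOn 𝓘(ℝ, E) (𝓘(ℝ, E).prod 𝓘(ℝ, E →L[ℝ] E →L[ℝ] ℝ)) ∞ (fun y : E =>
      TotalSpace.mk' (E →L[ℝ] E →L[ℝ] ℝ)
        (E := fun x : M => TangentSpace 𝓘(ℝ, E) x →L[ℝ] TangentSpace 𝓘(ℝ, E) x →L[ℝ] ℝ)
        (φ.symm y) (h.inner (φ.symm y))) φ.target :=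
    h.contMDiff.comp_contMDiffOn (contMDiffOn_chart_symm hφ)
  have h2 := ContMDiffOn.clm_bundle_apply₂ (F₁ := E) (F₂ := E) (F₃ := ℝ)
    (E₁ := fun x : M => TangentSpace 𝓘(ℝ, E) x) (E₂ := fun x : M => TangentSpace 𝓘(ℝ, E) x)
    (E₃ := Bundle.Trivial M ℝ) h1 (contMDiffOn_dsymm hφ v)
    (contMDiffOn_dsymm hφ w)
  intro y hy
  have h3 := (contMDiffWithinAt_totalSpace.1 (h2 y hy)).2
  exact h3.contDiffWithinAt

theorem contDiffOn_chartWind {W : ∀ x : M, TangentSpace 𝓘(ℝ, E) x}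
    (hW : ContMDiff 𝓘(ℝ, E) 𝓘(ℝ, E).tangent ∞ (fun x => (⟨x, W x⟩ : TangentBundle 𝓘(ℝ, E) M)))
    (hφ : φ ∈ atlas E M) : ContDiffOn ℝ ∞ (chartWind W φ) φ.target := by
  have h1 := (contMDiffOn_chart hφ).contMDiffOn_tangentMapWithin (m := ∞) (by simp)
    φ.open_source.uniqueMDiffOn
  have h2 := h1.comp (hW.comp_contMDiffOn (contMDiffOn_chart_symm hφ))
    (fun y hy => φ.map_target hy)
  have h3 := (contMDiff_snd_tangentBundle_modelSpace E 𝓘(ℝ, E)).comp_contMDiffOn h2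
  refine h3.contDiffOn.congr fun y hy => ?_
  have h4 := mfderivWithin_of_isOpen (I := 𝓘(ℝ, E)) (I' := 𝓘(ℝ, E)) (f := φ) φ.open_source
    (φ.map_target hy)
  exact (DFunLike.congr_fun h4 (W (φ.symm y))).symm

theorem contDiffOn_comp_chart_symm {s : M → ℝ} (hs : ContMDiff 𝓘(ℝ, E) 𝓘(ℝ, ℝ) ∞ s)
    (hφ : φ ∈ atlas E M) : ContDiffOn ℝ ∞ (s ∘ φ.symm) φ.target := by
  have h1 : ContMDiffOn 𝓘(ℝ, E) 𝓘(ℝ, ℝ) ∞ (s ∘ φ.symm) φ.target :=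
    ContMDiff.comp_contMDiffOn (I' := 𝓘(ℝ, E)) hs (contMDiffOn_chart_symm hφ)
  exact contMDiffOn_iff_contDiffOn.1 h1

theorem chartForm_symm (h : Metric E M) (φ : OpenPartialHomeomorph M E) (y v w : E) :
    chartForm h φ y v w = chartForm h φ y w v := by
  rw [chartForm_apply, chartForm_apply, h.symm]

theorem chartForm_pos (h : Metric E M) (hφ : φ ∈ atlas E M) {y : E} (hy : y ∈ φ.target) (v : E)
    (hv : v ≠ 0) : 0 < chartForm h φ y v v := by
  refine h.pos _ _ fun h0 => hv ?_
  rw [← dchart_dsymm hφ hy v]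
  exact (congrArg _ h0).trans (map_zero (dchart φ (φ.symm y)))

theorem hnorm_sq (h : Metric E M) (x : M) (u : TangentSpace 𝓘(ℝ, E) x) :
    hnorm h x u ^ 2 = h.inner x u u := by
  refine Real.sq_sqrt ?_
  rcases eq_or_ne u 0 with rfl | hu
  · simp
  · exact (h.pos x u hu).le

theorem hnorm_eq_iff (h : Metric E M) {x : M} (u : TangentSpace 𝓘(ℝ, E) x) {c : ℝ} (hc : 0 ≤ c) :
    hnorm h x u = c ↔ h.inner x u u = c ^ 2 := by
  rw [← hnorm_sq, sq_eq_sq₀ (show 0 ≤ hnorm h x u from Real.sqrt_nonneg _) hc]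

/-- The Lagrangian of the navigation problem in a chart. -/
theorem lag_chart (h : Metric E M) (W : ∀ x : M, TangentSpace 𝓘(ℝ, E) x) (s : M → ℝ)
    (hφ : φ ∈ atlas E M) {x : M} (hx : x ∈ φ.source) (u : TangentSpace 𝓘(ℝ, E) x) :
    lag (chartForm h φ) (windB (chartForm h φ) (chartWind W φ))
      (windD (chartForm h φ) (chartWind W φ) (s ∘ φ.symm)) (φ x)
      (dchart φ x u) = h.inner x (u - W x) (u - W x) - s x ^ 2 := by
  rw [lag_wind (chartForm_symm h φ _), inner_eq_chartForm h hφ hx, chartWind_eq W hx,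
    Function.comp_apply, φ.left_inv hx, map_sub (dchart φ x)]

end Charts

/-! ### Trajectories in charts and local optimality of extremals -/

section Curves

theorem eventuallyEq_symm_chart {E M : Type*} [TopologicalSpace E] [TopologicalSpace M]
    {φ : OpenPartialHomeomorph M E} {γ : ℝ → M} {t : ℝ} (hγ : ContinuousAt γ t)
    (ht : γ t ∈ φ.source) : γ =ᶠ[𝓝 t] φ.symm ∘ (φ ∘ γ) := by
  filter_upwards [hγ.eventually (φ.open_source.mem_nhds ht)] with s hs
  exact (φ.left_inv hs).symm

variable {E : Type*} [NormedAddCommGroup E] [NormedSpace ℝ E]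
  {M : Type*} [TopologicalSpace M] [ChartedSpace E M] [IsManifold 𝓘(ℝ, E) ∞ M]
  {φ : OpenPartialHomeomorph M E}

/-- The velocity of a curve in a chart. -/
theorem hasDerivAt_chart_comp (hφ : φ ∈ atlas E M) {γ : ℝ → M} {t : ℝ} (ht : γ t ∈ φ.source)
    (hγ : MDifferentiableAt 𝓘(ℝ, ℝ) 𝓘(ℝ, E) γ t) :
    HasDerivAt (φ ∘ γ) (dchart φ (γ t) (velocity E γ t)) t := by
  have h1 : HasMFDerivAt 𝓘(ℝ, ℝ) 𝓘(ℝ, E) (φ ∘ γ) t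
      ((mfderiv 𝓘(ℝ, E) 𝓘(ℝ, E) φ (γ t)).comp (mfderiv 𝓘(ℝ, ℝ) 𝓘(ℝ, E) γ t)) :=
    HasMFDerivAt.comp t
      ((mdifferentiable_chart_of_mem_atlas hφ).mdifferentiableAt ht).hasMFDerivAt hγ.hasMFDerivAt
  let L : ℝ →L[ℝ] E :=
    (mfderiv 𝓘(ℝ, E) 𝓘(ℝ, E) φ (γ t)).comp (mfderiv 𝓘(ℝ, ℝ) 𝓘(ℝ, E) γ t)
  have h2 : HasFDerivAt (φ ∘ γ) L t := hasMFDerivAt_iff_hasFDerivAt.1 h1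
  exact h2.hasDerivAt

theorem contMDiffAt_of_chart (hφ : φ ∈ atlas E M) {γ : ℝ → M} {t : ℝ} (hγ : ContinuousAt γ t)
    (ht : γ t ∈ φ.source) (hd : ContDiffAt ℝ 1 (φ ∘ γ) t) :
    ContMDiffAt 𝓘(ℝ, ℝ) 𝓘(ℝ, E) 1 γ t := by
  have h1 : ContMDiffAt 𝓘(ℝ, E) 𝓘(ℝ, E) 1 φ.symm ((φ ∘ γ) t) :=
    ((contMDiffOn_chart_symm hφ).contMDiffAt
      (φ.open_target.mem_nhds (φ.map_source ht))).of_le (by norm_num)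
  exact (ContMDiffAt.comp t h1 hd.contMDiffAt).congr_of_eventuallyEq
    (eventuallyEq_symm_chart hγ ht)

theorem mdifferentiableAt_of_chart (hφ : φ ∈ atlas E M) {γ : ℝ → M} {t : ℝ}
    (hγ : ContinuousAt γ t) (ht : γ t ∈ φ.source) {v : E} (hd : HasDerivAt (φ ∘ γ) v t) :
    MDifferentiableAt 𝓘(ℝ, ℝ) 𝓘(ℝ, E) γ t := by
  have h1 : MDifferentiableAt 𝓘(ℝ, E) 𝓘(ℝ, E) φ.symm ((φ ∘ γ) t) :=
    (mdifferentiable_chart_of_mem_atlas hφ).mdifferentiableAt_symm (φ.map_source ht)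
  exact (MDifferentiableAt.comp t h1 hd.differentiableAt.mdifferentiableAt).congr_of_eventuallyEq
    (eventuallyEq_symm_chart hγ ht)

theorem dchart_velocity (hφ : φ ∈ atlas E M) {γ : ℝ → M} {t : ℝ}
    (hγ : ContinuousAt γ t) (ht : γ t ∈ φ.source) {v : E} (hd : HasDerivAt (φ ∘ γ) v t) :
    dchart φ (γ t) (velocity E γ t) = v :=
  (hasDerivAt_chart_comp hφ ht (mdifferentiableAt_of_chart hφ hγ ht hd)).unique hd

variable {h : Metric E M} {W : ∀ x : M, TangentSpace 𝓘(ℝ, E) x} {s : M → ℝ}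

/-- A point outside a finite set has a closed interval around it that also avoids the set. The curve
is `C¹` there, hence differentiable in the two-sided sense. -/
theorem IsTrajectory.exists_finset {γ : ℝ → M} {a b : ℝ} (hγ : IsTrajectory h W s γ a b) :
    ∃ S : Finset ℝ, ∀ t ∈ Ioo a b, t ∉ S → MDifferentiableAt 𝓘(ℝ, ℝ) 𝓘(ℝ, E) γ t ∧
      hnorm h (γ t) (velocity E γ t - W (γ t)) = s (γ t) := by
  obtain ⟨-, S, h1, h2⟩ := hγ
  refine ⟨S, fun t ht htS => ⟨?_, h2 t ht htS⟩⟩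
  have hnh : Ioo a b ∩ (S : Set ℝ)ᶜ ∈ 𝓝 t :=
    inter_mem (Ioo_mem_nhds ht.1 ht.2) ((Finset.finite_toSet S).isClosed.isOpen_compl.mem_nhds htS)
  obtain ⟨ε, hε, hball⟩ := Metric.mem_nhds_iff.1 hnh
  have hin : ∀ r ∈ Icc (t - ε / 2) (t + ε / 2), r ∈ Ioo a b ∩ (S : Set ℝ)ᶜ := fun r hr => by
    refine hball ?_
    rw [Metric.mem_ball, Real.dist_eq, abs_lt]
    exact ⟨by linarith [hr.1], by linarith [hr.2]⟩
  have hlt : t - ε / 2 < t + ε / 2 := by linarith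
  have := h1 (t - ε / 2) (t + ε / 2) (hin _ (left_mem_Icc.2 hlt.le)).1.1.le hlt
    (hin _ (right_mem_Icc.2 hlt.le)).1.2.le (fun r hr => (hin r (Ioo_subset_Icc_self hr)).2)
  exact (this.contMDiffAt (Icc_mem_nhds (by linarith) (by linarith))).mdifferentiableAt one_ne_zero

theorem isTrajectory_of_contMDiffAt {γ : ℝ → M} {a b : ℝ}
    (hγ : ∀ t ∈ Icc a b, ContMDiffAt 𝓘(ℝ, ℝ) 𝓘(ℝ, E) 1 γ t)
    (hs : ∀ t ∈ Icc a b, hnorm h (γ t) (velocity E γ t - W (γ t)) = s (γ t)) :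
    IsTrajectory h W s γ a b :=
  ⟨fun t ht => (hγ t ht).continuousAt.continuousWithinAt, ∅,
    fun _ _ hc _ hd _ t ht =>
      (hγ t ⟨hc.trans ht.1, ht.2.trans hd⟩).contMDiffWithinAt,
    fun t ht _ => hs t (Ioo_subset_Icc_self ht)⟩

/-- The Lagrangian of the navigation problem in a chart. -/
noncomputable def chartLag (h : Metric E M) (W : ∀ x : M, TangentSpace 𝓘(ℝ, E) x) (s : M → ℝ)
    (φ : OpenPartialHomeomorph M E) : E → E → ℝ :=
  lag (chartForm h φ) (windB (chartForm h φ) (chartWind W φ))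
      (windD (chartForm h φ) (chartWind W φ) (s ∘ φ.symm))

theorem chartLag_eq_zero_iff (hφ : φ ∈ atlas E M) {x : M} (hx : x ∈ φ.source)
    (hs : 0 ≤ s x) (u : TangentSpace 𝓘(ℝ, E) x) :
    chartLag h W s φ (φ x) (dchart φ x u) = 0 ↔ hnorm h x (u - W x) = s x := by
  rw [chartLag, lag_chart h W s hφ hx, sub_eq_zero, hnorm_eq_iff h _ hs]

/-- A curve which is `C¹` in a chart and satisfies the equation of motion is a trajectory. -/
theorem isTrajectory_symm_comp (hφ : φ ∈ atlas E M) (hs : ∀ x, 0 ≤ s x) {y v : ℝ → E} {a b : ℝ}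
    (hy : ∀ t ∈ Icc a b, y t ∈ φ.target) (hyd : ∀ t ∈ Icc a b, ContDiffAt ℝ 1 y t)
    (hv : ∀ t ∈ Icc a b, HasDerivAt y (v t) t)
    (hlag : ∀ t ∈ Icc a b, chartLag h W s φ (y t) (v t) = 0) :
    IsTrajectory h W s (φ.symm ∘ y) a b := by
  have hsrc : ∀ t ∈ Icc a b, (φ.symm ∘ y) t ∈ φ.source := fun t ht => φ.map_target (hy t ht)
  have hc : ∀ t ∈ Icc a b, ContinuousAt (φ.symm ∘ y) t := fun t ht =>
    ContinuousAt.comp (φ.continuousAt_symm (hy t ht)) (hv t ht).continuousAt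
  have heq : ∀ t ∈ Icc a b, φ ∘ (φ.symm ∘ y) =ᶠ[𝓝 t] y := fun t ht => by
    filter_upwards [(hv t ht).continuousAt.eventually (φ.open_target.mem_nhds (hy t ht))] with r hr
    exact φ.right_inv hr
  refine isTrajectory_of_contMDiffAt (fun t ht => contMDiffAt_of_chart hφ (hc t ht) (hsrc t ht)
    ((hyd t ht).congr_of_eventuallyEq (heq t ht))) fun t ht => ?_
  rw [← chartLag_eq_zero_iff hφ (hsrc t ht) (hs _), dchart_velocity hφ (hc t ht) (hsrc t ht)
    ((hv t ht).congr_of_eventuallyEq (heq t ht))]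
  convert hlag t ht using 2
  exact φ.right_inv (hy t ht)

theorem contDiffAt_chartForm [FiniteDimensional ℝ E] (h : Metric E M) (hφ : φ ∈ atlas E M) {y : E}
    (hy : y ∈ φ.target) : ContDiffAt ℝ 2 (chartForm h φ) y :=
  ((contDiffOn_chartForm h hφ).contDiffAt (φ.open_target.mem_nhds hy)).of_le (by norm_cast)

theorem contDiffAt_chartWind
    (hW : ContMDiff 𝓘(ℝ, E) 𝓘(ℝ, E).tangent ∞ (fun x => (⟨x, W x⟩ : TangentBundle 𝓘(ℝ, E) M)))
    (hφ : φ ∈ atlas E M) {y : E} (hy : y ∈ φ.target) : ContDiffAt ℝ 2 (chartWind W φ) y :=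
  ((contDiffOn_chartWind hW hφ).contDiffAt (φ.open_target.mem_nhds hy)).of_le (by norm_cast)

theorem contDiffAt_comp_chart_symm (hs : ContMDiff 𝓘(ℝ, E) 𝓘(ℝ, ℝ) ∞ s)
    (hφ : φ ∈ atlas E M) {y : E} (hy : y ∈ φ.target) : ContDiffAt ℝ 2 (s ∘ φ.symm) y :=
  ((contDiffOn_comp_chart_symm hs hφ).contDiffAt (φ.open_target.mem_nhds hy)).of_le (by norm_cast)

/-- The velocities of trajectories are bounded near a point. -/
theorem exists_velocity_bound [FiniteDimensional ℝ E]
    (hW : ContMDiff 𝓘(ℝ, E) 𝓘(ℝ, E).tangent ∞ (fun x => (⟨x, W x⟩ : TangentBundle 𝓘(ℝ, E) M)))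
    (hs : ∀ x, |s x| ≤ 1) (hφ : φ ∈ atlas E M) {y₀ : E} (hy₀ : y₀ ∈ φ.target) :
    ∃ C > 0, ∀ᶠ y in 𝓝 y₀, ∀ v, chartLag h W s φ y v = 0 → ‖v‖ ≤ C := by
  obtain ⟨a, ha, hlow⟩ := exists_posDef_lower_bound (contDiffAt_chartForm h hφ hy₀).continuousAt
    (chartForm_pos h hφ hy₀)
  have hw : ∀ᶠ y in 𝓝 y₀, ‖chartWind W φ y‖ < ‖chartWind W φ y₀‖ + 1 :=
    (contDiffAt_chartWind hW hφ hy₀).continuousAt.norm.eventually_lt_const (by simp)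
  refine ⟨Real.sqrt (1 / a) + (‖chartWind W φ y₀‖ + 1), by positivity, ?_⟩
  filter_upwards [hlow, hw] with y h1 h2 v hv
  rw [chartLag, lag_wind (chartForm_symm h φ _), sub_eq_zero] at hv
  have h3 := h1 (v - chartWind W φ y)
  have h4 : (s ∘ φ.symm) y ^ 2 ≤ 1 := (sq_le_one_iff_abs_le_one _).2 (hs _)
  have h5 : ‖v - chartWind W φ y‖ ≤ Real.sqrt (1 / a) := by
    refine Real.le_sqrt_of_sq_le ?_
    rw [le_div_iff₀ ha]
    linarith
  calc ‖v‖ = ‖(v - chartWind W φ y) + chartWind W φ y‖ := by rw [sub_add_cancel]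
    _ ≤ ‖v - chartWind W φ y‖ + ‖chartWind W φ y‖ := norm_add_le _ _
    _ ≤ _ := by linarith

/-- Short trajectories starting near a point stay near it. -/
theorem exists_trajectory_mem_ball [FiniteDimensional ℝ E] [T2Space M]
    (hW : ContMDiff 𝓘(ℝ, E) 𝓘(ℝ, E).tangent ∞ (fun x => (⟨x, W x⟩ : TangentBundle 𝓘(ℝ, E) M)))
    (hs : ∀ x, 0 ≤ s x ∧ s x ≤ 1) (hφ : φ ∈ atlas E M) {y₀ : E} (hy₀ : y₀ ∈ φ.target) {r : ℝ}
    (hr : 0 < r) :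
    ∃ δ > 0, ∀ (σ : ℝ → M) (T : ℝ), T ≤ δ → IsTrajectory h W s σ 0 T → σ 0 ∈ φ.source →
      φ (σ 0) ∈ Metric.ball y₀ δ → ∀ t ∈ Icc 0 T, σ t ∈ φ.source ∧ φ (σ t) ∈ Metric.ball y₀ r := by
  obtain ⟨C, hC, hbd⟩ := exists_velocity_bound (h := h) hW
    (fun x => abs_le.2 ⟨by linarith [(hs x).1], (hs x).2⟩) hφ hy₀
  obtain ⟨r₁, hr₁, hball⟩ := Metric.mem_nhds_iff.1
    (inter_mem (φ.open_target.mem_nhds hy₀) hbd)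
  set r₂ := min r (r₁ / 2) with hr₂
  have hr₂pos : 0 < r₂ := by positivity
  have hcl : Metric.closedBall y₀ r₂ ⊆ Metric.ball y₀ r₁ :=
    Metric.closedBall_subset_ball (by linarith [min_le_right r (r₁ / 2)])
  -- The curve might leave the chart domain at its first exit time from `U`. As `M` is Hausdorff,
  -- the compact set `K` is closed, so the curve is still in `K`, inside the chart, at that time.
  -- The velocity bound `C` then shows that it has not travelled far enough to exit.
  set K := φ.symm '' Metric.closedBall y₀ r₂ with hK
  have hKc : IsClosed K := by
    have := FiniteDimensional.proper_real E
    refine ((isCompact_closedBall y₀ r₂).image_of_continuousOn ?_).isClosed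
    exact φ.continuousOn_symm.mono fun y hy => (hball (hcl hy)).1
  have hKs : K ⊆ φ.source := by
    rintro _ ⟨y, hy, rfl⟩
    exact φ.map_target (hball (hcl hy)).1
  have hKφ : ∀ x ∈ K, φ x ∈ Metric.closedBall y₀ r₂ := by
    rintro _ ⟨y, hy, rfl⟩
    rwa [φ.right_inv (hball (hcl hy)).1]
  set U := φ.source ∩ φ ⁻¹' Metric.ball y₀ r₂ with hU
  have hUo : IsOpen U := φ.isOpen_inter_preimage Metric.isOpen_ball
  have hUK : U ⊆ K := fun x hx =>
    ⟨φ x, Metric.ball_subset_closedBall hx.2, φ.left_inv hx.1⟩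
  refine ⟨r₂ / (2 * (C + 1)), by positivity, fun σ T hT hσ hσ0 hσ0' => ?_⟩
  have hδ : r₂ / (2 * (C + 1)) ≤ r₂ / 2 := by
    gcongr
    linarith
  have hCδ : C * (r₂ / (2 * (C + 1))) ≤ r₂ / 2 := by
    calc C * (r₂ / (2 * (C + 1))) ≤ (C + 1) * (r₂ / (2 * (C + 1))) := by
          gcongr
          linarith
      _ = r₂ / 2 := by field_simp
  suffices hall : ∀ t ∈ Icc 0 T, σ t ∈ U from fun t ht =>
    ⟨(hall t ht).1, Metric.ball_subset_ball (min_le_left _ _) (hall t ht).2⟩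
  by_contra! hne
  obtain ⟨t₁, ht₁, ht₁U⟩ := hne
  have hσc := hσ.1
  have hcomp : IsCompact (Icc 0 T ∩ σ ⁻¹' Uᶜ) :=
    isCompact_Icc.of_isClosed_subset (hσc.preimage_isClosed_of_isClosed isClosed_Icc
      hUo.isClosed_compl) inter_subset_left
  obtain ⟨t₀, ht₀, hleast⟩ := hcomp.exists_isLeast ⟨t₁, ht₁, ht₁U⟩
  have hσ0U : σ 0 ∈ U := ⟨hσ0, Metric.ball_subset_ball (by linarith) hσ0'⟩
  have ht₀pos : 0 < t₀ := ht₀.1.1.lt_of_ne fun h0 => ht₀.2 (h0 ▸ hσ0U)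
  have hbefore : ∀ t ∈ Ico 0 t₀, σ t ∈ U := fun t ht => by
    by_contra hU'
    exact absurd (hleast ⟨⟨ht.1, ht.2.le.trans ht₀.1.2⟩, hU'⟩) (not_le.2 ht.2)
  have hσc' : ContinuousOn σ (Icc 0 t₀) := hσc.mono (Icc_subset_Icc le_rfl ht₀.1.2)
  have hKall : ∀ t ∈ Icc 0 t₀, σ t ∈ K := by
    have hm : MapsTo σ (Ico 0 t₀) K := fun t ht => hUK (hbefore t ht)
    have := hm.closure_of_continuousOn (by rwa [closure_Ico ht₀pos.ne])
    rwa [closure_Ico ht₀pos.ne, hKc.closure_eq] at this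
  obtain ⟨S, hS⟩ := hσ.exists_finset
  have hmv := norm_sub_le_of_hasDerivAt_off_finset (f := φ ∘ σ)
    (f' := fun t => dchart φ (σ t) (velocity E σ t)) (C := C) S ht₀pos.le
    (φ.continuousOn.comp hσc' fun t ht => hKs (hKall t ht))
    (fun t ht htS => hasDerivAt_chart_comp hφ (hKs (hKall t (Ioo_subset_Icc_self ht)))
      (hS t ⟨ht.1, ht.2.trans_le ht₀.1.2⟩ htS).1)
    (fun t ht htS => by
      have hk := hKall t (Ioo_subset_Icc_self ht)
      refine (hball (hcl (hKφ _ hk))).2 _ ?_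
      rw [chartLag_eq_zero_iff hφ (hKs hk) (hs _).1]
      exact (hS t ⟨ht.1, ht.2.trans_le ht₀.1.2⟩ htS).2)
  refine ht₀.2 ⟨hKs (hKall t₀ (right_mem_Icc.2 ht₀pos.le)), ?_⟩
  rw [mem_preimage, mem_ball_iff_norm]
  rw [mem_ball_iff_norm] at hσ0'
  have hCt : C * (t₀ - 0) ≤ C * (r₂ / (2 * (C + 1))) := by
    gcongr
    linarith [ht₀.1.2]
  calc ‖φ (σ t₀) - y₀‖ = ‖((φ ∘ σ) t₀ - (φ ∘ σ) 0) + (φ (σ 0) - y₀)‖ := by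
        congr 1
        simp only [Function.comp_apply]
        abel
    _ ≤ ‖(φ ∘ σ) t₀ - (φ ∘ σ) 0‖ + ‖φ (σ 0) - y₀‖ := norm_add_le _ _
    _ < r₂ := by linarith

/-- By convexity along the ray from `0`, where the Lagrangian is `D < 0`: slowing down an admissible
velocity moves it strictly inside the ellipsoid. -/
theorem lag_smul_neg {A : E → E →L[ℝ] E →L[ℝ] ℝ} {B : E → E →L[ℝ] ℝ} {D : E → ℝ} {y v : E}
    (hA : 0 ≤ A y v v) (hD : D y < 0) (h0 : lag A B D y v = 0) {c : ℝ} (hc : 0 ≤ c) (hc1 : c < 1) :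
    lag A B D y (c • v) < 0 := by
  have e : lag A B D y (c • v) = c * lag A B D y v - c * (1 - c) * A y v v + (1 - c) * D y := by
    simp only [lag, map_smul, smul_apply, smul_eq_mul]
    ring
  rw [e, h0]
  have h1 : 0 ≤ c * (1 - c) * A y v v := mul_nonneg (mul_nonneg hc (by linarith)) hA
  have h2 : (1 - c) * D y < 0 := mul_neg_of_pos_of_neg (by linarith) hD
  linarith

theorem isLagrangianAt_chart [FiniteDimensional ℝ E]
    (hW : ContMDiff 𝓘(ℝ, E) 𝓘(ℝ, E).tangent ∞ (fun x => (⟨x, W x⟩ : TangentBundle 𝓘(ℝ, E) M)))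
    (hsm : ContMDiff 𝓘(ℝ, E) 𝓘(ℝ, ℝ) ∞ s) (hφ : φ ∈ atlas E M) {y₀ : E} (hy₀ : y₀ ∈ φ.target) :
    IsLagrangianAt (chartForm h φ) (windB (chartForm h φ) (chartWind W φ))
      (windD (chartForm h φ) (chartWind W φ) (s ∘ φ.symm)) y₀ :=
  isLagrangianAt_wind (contDiffAt_chartForm h hφ hy₀) (contDiffAt_chartWind hW hφ hy₀)
    (contDiffAt_comp_chart_symm hsm hφ hy₀) (Eventually.of_forall (chartForm_symm h φ))
    (chartForm_pos h hφ hy₀)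

theorem windD_chart_neg (hφ : φ ∈ atlas E M) (hWs : ∀ x, hnorm h x (W x) < s x) {y : E}
    (hy : y ∈ φ.target) : windD (chartForm h φ) (chartWind W φ) (s ∘ φ.symm) y < 0 := by
  have h1 : chartForm h φ y (chartWind W φ y) (chartWind W φ y) =
      h.inner (φ.symm y) (W (φ.symm y)) (W (φ.symm y)) := by
    rw [inner_eq_chartForm h hφ (φ.map_target hy), φ.right_inv hy]
    rfl
  rw [windD, h1, ← hnorm_sq, sub_neg]
  exact pow_lt_pow_left₀ (hWs _) (Real.sqrt_nonneg _) two_ne_zero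

/-- Extremals are locally time-optimal. -/
theorem exists_nhds_optimal [FiniteDimensional ℝ E] [T2Space M]
    (hW : ContMDiff 𝓘(ℝ, E) 𝓘(ℝ, E).tangent ∞ (fun x => (⟨x, W x⟩ : TangentBundle 𝓘(ℝ, E) M)))
    (hsm : ContMDiff 𝓘(ℝ, E) 𝓘(ℝ, ℝ) ∞ s) (hs1 : ∀ x, s x ≤ 1)
    (hWs : ∀ x, hnorm h x (W x) < s x) (hφ : φ ∈ atlas E M) {γ : ℝ → M} {t₀ : ℝ}
    {v : ℝ → E} {p : ℝ → E →L[ℝ] ℝ} {μ : ℝ → ℝ} (hsrc : ∀ᶠ t in 𝓝 t₀, γ t ∈ φ.source)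
    (hv : ContinuousAt v t₀) (hμ : ContinuousAt μ t₀) (hμ0 : 0 < μ t₀)
    (hx : ∀ᶠ t in 𝓝 t₀, HasDerivAt (φ ∘ γ) (v t) t)
    (hp : ∀ᶠ t in 𝓝 t₀,
      p t = μ t • lagV (chartForm h φ) (windB (chartForm h φ) (chartWind W φ)) (φ (γ t)) (v t))
    (hpd : ∀ᶠ t in 𝓝 t₀, HasDerivAt p (μ t • lagX (chartForm h φ)
      (windB (chartForm h φ) (chartWind W φ))
      (windD (chartForm h φ) (chartWind W φ) (s ∘ φ.symm)) (φ (γ t)) (v t)) t)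
    (hlag : ∀ᶠ t in 𝓝 t₀, chartLag h W s φ (φ (γ t)) (v t) = 0) :
    ∃ U ∈ 𝓝 t₀, ∀ t₁ ∈ U, ∀ t₂ ∈ U, t₁ ≤ t₂ → ∀ (σ : ℝ → M) (T : ℝ), 0 ≤ T →
      IsTrajectory h W s σ 0 T → σ 0 = γ t₁ → σ T = γ t₂ → t₂ - t₁ ≤ T := by
  have hs0 : ∀ x, 0 < s x := fun x => (Real.sqrt_nonneg _).trans_lt (hWs x)
  have hy₀ : φ (γ t₀) ∈ φ.target := φ.map_source hsrc.self_of_nhds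
  set y₀ := φ (γ t₀) with hy₀def
  have hL := isLagrangianAt_chart (h := h) hW hsm hφ hy₀
  obtain ⟨r, hr, ε, hε, hmain⟩ :=
    hL.eqOn_of_extremal (‖v t₀‖ + 1) (m₀ := μ t₀ / 2) (m₁ := μ t₀ + 1) (half_pos hμ0)
  obtain ⟨δ, hδ, hstay⟩ := exists_trajectory_mem_ball (h := h) hW
    (fun x => ⟨(hs0 x).le, hs1 x⟩) hφ hy₀ hr
  have hyc : ContinuousAt (φ ∘ γ) t₀ := hx.self_of_nhds.continuousAt
  have hev : ∀ᶠ t in 𝓝 t₀, (γ t ∈ φ.source ∧ HasDerivAt (φ ∘ γ) (v t) t ∧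
      chartLag h W s φ (φ (γ t)) (v t) = 0) ∧
      ((φ ∘ γ) t ∈ Metric.ball y₀ r ∧ (φ ∘ γ) t ∈ Metric.ball y₀ δ ∧ ‖v t‖ ≤ ‖v t₀‖ + 1) ∧
      (μ t₀ / 2 ≤ μ t ∧ μ t ≤ μ t₀ + 1) ∧
      p t = μ t • lagV (chartForm h φ) (windB (chartForm h φ) (chartWind W φ)) (φ (γ t)) (v t) ∧
      HasDerivAt p (μ t • lagX (chartForm h φ)
        (windB (chartForm h φ) (chartWind W φ))
        (windD (chartForm h φ) (chartWind W φ) (s ∘ φ.symm)) (φ (γ t)) (v t)) t := by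
    filter_upwards [hsrc, hx, hlag, hyc.eventually (Metric.ball_mem_nhds _ hr),
      hyc.eventually (Metric.ball_mem_nhds _ hδ),
      hv.norm.eventually_lt_const (show ‖v t₀‖ < ‖v t₀‖ + 1 by simp),
      hμ.eventually_const_lt (show μ t₀ / 2 < μ t₀ by linarith),
      hμ.eventually_lt_const (show μ t₀ < μ t₀ + 1 by simp), hp, hpd]
      with t h1 h2 h3 h4 h5 h6 h7 h8 h9 h10
    exact ⟨⟨h1, h2, h3⟩, ⟨h4, h5, h6.le⟩, ⟨h7.le, h8.le⟩, h9, h10⟩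
  obtain ⟨η, hη, hηev⟩ := Metric.eventually_nhds_iff_ball.1 hev
  refine ⟨Metric.ball t₀ (min η (min (ε / 2) (δ / 2))),
    Metric.ball_mem_nhds _ (by positivity), ?_⟩
  intro t₁ ht₁ t₂ ht₂ ht₁₂ σ T hT hσ hσ0 hσT
  by_contra! hlt
  rw [Metric.mem_ball, Real.dist_eq, lt_min_iff, lt_min_iff, abs_lt, abs_lt, abs_lt] at ht₁ ht₂
  have hin : ∀ t ∈ Icc t₁ t₂, t ∈ Metric.ball t₀ η := fun t ht => by
    rw [Metric.mem_ball, Real.dist_eq, abs_lt]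
    exact ⟨by linarith [ht.1, ht₁.1.1], by linarith [ht.2, ht₂.1.2]⟩
  have hlen : 0 < t₂ - t₁ := hT.trans_lt hlt
  have hlenε : t₂ - t₁ ≤ ε := by linarith [ht₁.2.1.1, ht₂.2.1.2]
  have hlenδ : T ≤ δ := by linarith [ht₁.2.2.1, ht₂.2.2.2]
  have hl1 : t₁ ∈ Icc t₁ t₂ := left_mem_Icc.2 ht₁₂
  have hin1 := hηev t₁ (hin t₁ hl1)
  have hball := hstay σ T hlenδ hσ (hσ0 ▸ hin1.1.1) (hσ0 ▸ hin1.2.1.2.1)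
  -- The supposedly faster voyage is slowed down by `c < 1` to last exactly `t₂ - t₁`, which makes
  -- its Lagrangian strictly negative.
  set c := T / (t₂ - t₁) with hc
  have hc0 : 0 ≤ c := by positivity
  have hc1 : c < 1 := (div_lt_one hlen).2 hlt
  have hcT : c * (t₂ - t₁) = T := div_mul_cancel₀ _ hlen.ne'
  have hlin : ∀ t, HasDerivAt (fun t => c * (t - t₁)) c t := fun t => by
    simpa using ((hasDerivAt_id t).sub_const t₁).const_mul c
  have hmap : ∀ t ∈ Icc t₁ t₂, c * (t - t₁) ∈ Icc 0 T := fun t ht => by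
    refine ⟨mul_nonneg hc0 (sub_nonneg.2 ht.1), ?_⟩
    rw [← hcT]
    gcongr
    exact ht.2
  obtain ⟨S, hS⟩ := hσ.exists_finset
  set z : ℝ → E := fun t => φ (σ (c * (t - t₁))) with hz
  set u : ℝ → E := fun t => c • dchart φ (σ (c * (t - t₁))) (velocity E σ (c * (t - t₁))) with hu
  set S' : Finset ℝ := S.image (fun q => t₁ + q / c) with hS'
  have hzu : ∀ t ∈ Ioo t₁ t₂, t ∉ S' → HasDerivAt z (u t) t ∧
      lag (chartForm h φ) (windB (chartForm h φ) (chartWind W φ))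
        (windD (chartForm h φ) (chartWind W φ) (s ∘ φ.symm)) (z t) (u t) < 0 := by
    intro t ht htS
    have ht' := Ioo_subset_Icc_self ht
    have hb := hball _ (hmap t ht')
    have hD := windD_chart_neg hφ hWs (φ.map_source hb.1)
    -- If `T = 0`, the slowed curve is at rest and its Lagrangian is `D`. The set `S'`, which
    -- divides by `c`, matters only in the other case.
    rcases hc0.eq_or_lt with h0 | h0
    · constructor
      · have : z = fun _ => φ (σ 0) := by
          funext t
          simp [hz, ← h0]
        rw [this]
        simpa [hu, ← h0] using hasDerivAt_const t (φ (σ 0))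
      · simp only [hu, ← h0, zero_smul, lag, map_zero, zero_add]
        simpa [hz, ← h0] using hD
    · have hq : c * (t - t₁) ∈ Ioo 0 T := by
        refine ⟨mul_pos h0 (sub_pos.2 ht.1), ?_⟩
        rw [← hcT]
        gcongr
        exact ht.2
      have hqS : c * (t - t₁) ∉ S := fun hmem => htS (by
        rw [hS', Finset.mem_image]
        exact ⟨_, hmem, by field_simp; ring⟩)
      obtain ⟨hd, hn⟩ := hS _ hq hqS
      refine ⟨HasDerivAt.scomp (g₁ := φ ∘ σ) t (hasDerivAt_chart_comp hφ hb.1 hd) (hlin t), ?_⟩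
      refine lag_smul_neg ?_ hD ?_ hc0 hc1
      · rw [← inner_eq_chartForm h hφ hb.1, ← hnorm_sq]
        positivity
      · exact (chartLag_eq_zero_iff hφ hb.1 (hs0 _).le _).2 hn
  have heq := hmain t₁ t₂ (φ ∘ γ) v z u p μ S' hlenε
    (fun t ht => (hηev t (hin t ht)).2.1.1) (fun t ht => (hηev t (hin t ht)).2.1.2.2)
    (fun t ht => (hηev t (hin t ht)).2.2.1) (fun t ht => (hηev t (hin t ht)).1.2.1)
    (fun t ht => (hηev t (hin t ht)).2.2.2.1) (fun t ht => (hηev t (hin t ht)).2.2.2.2)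
    (by
      have h1 : ContinuousOn (fun t => σ (c * (t - t₁))) (Icc t₁ t₂) :=
        hσ.1.comp (by fun_prop) hmap
      exact φ.continuousOn.comp h1 fun t ht => (hball _ (hmap t ht)).1)
    (fun t ht => (hball _ (hmap t ht)).2) (fun t ht htS => (hzu t ht htS).1)
    (fun t ht htS => (hzu t ht htS).2.le.trans_eq
      (hηev t (hin t (Ioo_subset_Icc_self ht))).1.2.2.symm)
    (by simp [hz, hσ0]) (by simp [hz, hcT, hσT])
  -- The two curves coincide, so at any regular time the velocities agree, but one has Lagrangian
  -- `0` and the other a negative one.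
  obtain ⟨t, ht, htS⟩ := (Ioo_infinite (show t₁ < t₂ by linarith)).exists_notMem_finset S'
  have ht' := Ioo_subset_Icc_self ht
  have hu_eq : u t = v t := by
    refine (hzu t ht htS).1.unique
      ((hηev t (hin t ht')).1.2.1.congr_of_eventuallyEq ?_)
    filter_upwards [Ioo_mem_nhds ht.1 ht.2] with q hq
    exact heq (Ioo_subset_Icc_self hq)
  have h1 := (hzu t ht htS).2
  rw [hu_eq, heq ht'] at h1
  exact h1.ne (hηev t (hin t ht')).1.2.2

end Curves

/-! ### Regularity of curves and the case without wind -/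

theorem contDiffAt_succ_of_hasDerivAt {E : Type*} [NormedAddCommGroup E] [NormedSpace ℝ E]
    {n : ℕ} {y v : ℝ → E} {t : ℝ} (hy : ∀ᶠ r in 𝓝 t, HasDerivAt y (v r) r)
    (hv : ContDiffAt ℝ n v t) : ContDiffAt ℝ (n + 1) y t := by
  rw [contDiffAt_succ_iff_hasFDerivAt]
  refine ⟨fun r => ContinuousLinearMap.toSpanSingleton ℝ (v r), ⟨_, hy, fun r hr => hr⟩, ?_⟩
  exact (ContinuousLinearMap.toSpanSingletonCLE (𝕜 := ℝ) (E := E)).contDiff.contDiffAt.comp t hv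

theorem contDiffAt_one_of_hasDerivAt {E : Type*} [NormedAddCommGroup E] [NormedSpace ℝ E]
    {y v : ℝ → E} {t : ℝ} (hy : ∀ᶠ r in 𝓝 t, HasDerivAt y (v r) r)
    (hv : ∀ᶠ r in 𝓝 t, ContinuousAt v r) : ContDiffAt ℝ 1 y t := by
  have h0 : ContDiffAt ℝ (0 : ℕ) v t := by
    rw [Nat.cast_zero, contDiffAt_zero]
    exact ⟨_, hv, fun r hr => ContinuousAt.continuousWithinAt hr⟩
  simpa using contDiffAt_succ_of_hasDerivAt hy h0

theorem windB_zero {E : Type*} [NormedAddCommGroup E] [NormedSpace ℝ E]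
    (g : E → E →L[ℝ] E →L[ℝ] ℝ) : windB g 0 = 0 := by
  funext y
  simp [windB]

theorem windD_zero_const {E : Type*} [NormedAddCommGroup E] [NormedSpace ℝ E]
    (g : E → E →L[ℝ] E →L[ℝ] ℝ) (c : ℝ) :
    windD g 0 (fun _ => c) = fun _ => -c ^ 2 := by
  funext y
  simp [windD]

theorem chartWind_zero {E : Type*} [NormedAddCommGroup E] [NormedSpace ℝ E] {M : Type*}
    [TopologicalSpace M] [ChartedSpace E M] {W : ∀ x : M, TangentSpace 𝓘(ℝ, E) x}
    (hW0 : ∀ x, W x = 0) (φ : OpenPartialHomeomorph M E) :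
    chartWind W φ = 0 := by
  funext y
  rw [chartWind, hW0, map_zero]
  rfl

theorem continuousAt_of_chart {E M : Type*} [TopologicalSpace E] [TopologicalSpace M]
    {φ : OpenPartialHomeomorph M E} {γ : ℝ → M} {t : ℝ} (hsrc : ∀ᶠ r in 𝓝 t, γ r ∈ φ.source)
    (hc : ContinuousAt (φ ∘ γ) t) : ContinuousAt γ t := by
  have h1 : ContinuousAt (φ.symm ∘ (φ ∘ γ)) t :=
    ContinuousAt.comp (φ.continuousAt_symm (φ.map_source hsrc.self_of_nhds)) hc
  exact h1.congr (hsrc.mono fun r hr => φ.left_inv hr)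

/-! ### Solutions versus geodesics -/

section Solutions

variable {E : Type*} [NormedAddCommGroup E] [NormedSpace ℝ E]
  {M : Type*} [TopologicalSpace M] [ChartedSpace E M] [IsManifold 𝓘(ℝ, E) ∞ M]
  {φ : OpenPartialHomeomorph M E} {h : Metric E M} {W : ∀ x : M, TangentSpace 𝓘(ℝ, E) x}
  {s : M → ℝ}

theorem chartLag_zero_const (hW0 : ∀ x, W x = 0) {c : ℝ} (hsc : ∀ x, s x = c)
    (φ : OpenPartialHomeomorph M E) (y v : E) :
    chartLag h W s φ y v = chartForm h φ y v v - c ^ 2 := by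
  have : s ∘ φ.symm = fun _ => c := funext fun y => hsc _
  rw [chartLag, chartWind_zero hW0, this, windB_zero, windD_zero_const]
  simp [lag]
  ring

variable [FiniteDimensional ℝ E]

/-- On the diagonal the first two terms of the Christoffel symbol coincide, and the third is half
the position derivative of the energy. -/
theorem christoffel_eq (h : Metric E M) (hφ : φ ∈ atlas E M) {y : E} (hy : y ∈ φ.target)
    (v w : E) : christoffel h φ y v v w =
      fderiv ℝ (chartForm h φ) y v v w - (1 / 2) * lagX (chartForm h φ) 0 0 y v w := by
  have hd : DifferentiableAt ℝ (chartForm h φ) y :=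
    (contDiffAt_chartForm h hφ hy).differentiableAt (by norm_num)
  have key : ∀ a b c : E, fderiv ℝ (fun z => chartMetric h φ z a b) y c =
      fderiv ℝ (chartForm h φ) y c a b := by
    intro a b c
    have h1 : HasFDerivAt (fun z => chartForm h φ z a) ((fderiv ℝ (chartForm h φ) y).flip a) y := by
      simpa using hd.hasFDerivAt.clm_apply (hasFDerivAt_const a y)
    have h2 : HasFDerivAt (fun z => chartForm h φ z a b)
        (((fderiv ℝ (chartForm h φ) y).flip a).flip b) y := by
      simpa using h1.clm_apply (hasFDerivAt_const b y)
    simp only [chartMetric_eq]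
    rw [h2.fderiv]
    rfl
  rw [christoffel, key, key, lagX_metric_apply]
  ring

/-- The geodesic equation, in terms of the Euler–Lagrange derivative of the energy. -/
theorem geodesic_equation_iff (h : Metric E M) (hφ : φ ∈ atlas E M) {y : E} (hy : y ∈ φ.target)
    (v a : E) : (∀ w, chartMetric h φ y a w + christoffel h φ y v v w = 0) ↔
      chartForm h φ y a = (1 / 2 : ℝ) • lagX (chartForm h φ) 0 0 y v
        - fderiv ℝ (chartForm h φ) y v v := by
  rw [ContinuousLinearMap.ext_iff]
  refine forall_congr' fun w => ?_
  rw [christoffel_eq h hφ hy, chartMetric_eq]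
  simp only [sub_apply, smul_apply, smul_eq_mul]
  constructor <;> intro e <;> linarith

/-- Without wind and with constant own speed, solutions of the navigation problem are geodesics. -/
theorem isGeodesicOfSpeed_of_isSolution [Nontrivial E]
    (hW : ContMDiff 𝓘(ℝ, E) 𝓘(ℝ, E).tangent ∞ (fun x => (⟨x, W x⟩ : TangentBundle 𝓘(ℝ, E) M)))
    (hs1 : ∀ x, s x ≤ 1) (hW0 : ∀ x, W x = 0) {c : ℝ} (hc : 0 < c) (hsc : ∀ x, s x = c)
    {J : Set ℝ} (hJ : IsOpen J) {γ : ℝ → M} (hγ : IsSolution h W s γ J) :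
    IsGeodesicOfSpeed h c γ J := by
  have hs0 : ∀ x, 0 < s x := fun x => hc.trans_eq (hsc x).symm
  -- It suffices to identify `γ` near each time with an integral curve of the geodesic flow of
  -- energy `c²`. The `C²` regularity, which a trajectory need not have a priori, is then inherited
  -- from the flow.
  suffices key : ∀ t₀ ∈ J, ∃ φ ∈ atlas E M, (∀ᶠ t in 𝓝 t₀, γ t ∈ φ.source) ∧
      ∃ (x v : ℝ → E), (∀ᶠ t in 𝓝 t₀, (φ ∘ γ) t = x t) ∧ ContinuousAt γ t₀ ∧
      (∀ᶠ t in 𝓝 t₀, HasDerivAt x (v t) t ∧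
        HasDerivAt v (geodesicAcc (chartForm h φ) (x t) (v t)) t) ∧
      chartForm h φ (x t₀) (v t₀) (v t₀) = c ^ 2 by
    refine ⟨fun t₀ ht₀ => ?_, fun t₀ ht₀ => ?_⟩
    · obtain ⟨φ, hφ, hsrc, x, v, heq, -, hxv, -⟩ := key t₀ ht₀
      have hy₀ : x t₀ ∈ φ.target := heq.self_of_nhds ▸ φ.map_source hsrc.self_of_nhds
      have hacc : ContDiffAt ℝ 1 (fun z : E × E => geodesicAcc (chartForm h φ) z.1 z.2)
          (x t₀, v t₀) :=
        contDiffAt_geodesicAcc (contDiffAt_chartForm h hφ hy₀) (chartForm_pos h hφ hy₀) _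
      have hcacc : ∀ᶠ t in 𝓝 t₀,
          ContinuousAt (fun t => geodesicAcc (chartForm h φ) (x t) (v t)) t := by
        have h1 : ∀ᶠ z in 𝓝 (x t₀, v t₀),
            ContinuousAt (fun z : E × E => geodesicAcc (chartForm h φ) z.1 z.2) z :=
          (hacc.eventually (by simp)).mono fun z hz => hz.continuousAt
        have h2 : ContinuousAt (fun t => (x t, v t)) t₀ :=
          hxv.self_of_nhds.1.continuousAt.prodMk hxv.self_of_nhds.2.continuousAt
        filter_upwards [h2.eventually h1, hxv] with t h3 h4
        exact ContinuousAt.comp (f := fun t => (x t, v t))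
          (g := fun z : E × E => geodesicAcc (chartForm h φ) z.1 z.2) h3
          (h4.1.continuousAt.prodMk h4.2.continuousAt)
      have hv1 : ContDiffAt ℝ 1 v t₀ :=
        contDiffAt_one_of_hasDerivAt (hxv.mono fun t ht => ht.2) hcacc
      have hx2 : ContDiffAt ℝ 2 x t₀ := by
        have := contDiffAt_succ_of_hasDerivAt (n := 1) (hxv.mono fun t ht => ht.1)
          (by simpa using hv1)
        norm_num at this
        exact this
      refine ⟨φ, hφ, hsrc, hx2.congr_of_eventuallyEq heq, ?_⟩
      have hder : ∀ᶠ t in 𝓝 t₀, deriv (φ ∘ γ) t = v t := by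
        filter_upwards [eventually_eventually_nhds.2 heq, hxv] with t h1 h2
        exact (h2.1.congr_of_eventuallyEq h1).deriv
      filter_upwards [eventually_eventually_nhds.2 hder, hder, heq, hsrc, hxv]
        with t h1 h2 h3 h4 h5
      have hyt := φ.map_source h4
      rw [geodesic_equation_iff h hφ hyt, h2, (h5.2.congr_of_eventuallyEq h1).deriv,
        show φ (γ t) = x t from h3]
      exact apply_geodesicAcc (chartForm_pos h hφ (h3 ▸ hyt)) _
    · obtain ⟨φ, hφ, hsrc, x, v, heq, hcont, hxv, hsp⟩ := key t₀ ht₀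
      rw [hnorm_eq_iff h _ hc.le, inner_eq_chartForm h hφ hsrc.self_of_nhds,
        dchart_velocity hφ hcont hsrc.self_of_nhds
          (hxv.self_of_nhds.1.congr_of_eventuallyEq heq), ← hsp, ← heq.self_of_nhds]
      rfl
  intro t₀ ht₀
  obtain ⟨e, he, heJ⟩ := Metric.mem_nhds_iff.1 (hJ.mem_nhds ht₀)
  rw [Real.ball_eq_Ioo] at heJ
  have hcont : ContinuousAt γ t₀ := by
    have h1 := (hγ.1 (t₀ - e / 2) (heJ ⟨by linarith, by linarith⟩) (t₀ + e / 2)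
      (heJ ⟨by linarith, by linarith⟩) (by linarith)).1
    exact h1.continuousAt (Icc_mem_nhds (by linarith) (by linarith))
  set φ := chartAt E (γ t₀) with hφdef
  have hφ : φ ∈ atlas E M := chart_mem_atlas E _
  have hsrc₀ : γ t₀ ∈ φ.source := mem_chart_source E _
  have hy₀ : φ (γ t₀) ∈ φ.target := φ.map_source hsrc₀
  have hsrc : ∀ᶠ t in 𝓝 t₀, γ t ∈ φ.source := hcont.eventually (φ.open_source.mem_nhds hsrc₀)
  set y₀ := φ (γ t₀) with hy₀def
  set g := chartForm h φ with hg
  have hg2 : ContDiffAt ℝ 2 g y₀ := contDiffAt_chartForm h hφ hy₀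
  have hL : IsLagrangianAt g 0 0 y₀ :=
    ⟨hg2, contDiffAt_const, contDiffAt_const, Eventually.of_forall (chartForm_symm h φ),
      chartForm_pos h hφ hy₀⟩
  obtain ⟨C, hC, hbd⟩ := exists_velocity_bound (h := h) hW
    (fun x => abs_le.2 ⟨by linarith [hs0 x], hs1 x⟩) hφ hy₀
  obtain ⟨Λ, hΛ, hbvp⟩ := exists_geodesic_between hg2 hL.symm hL.pos
  obtain ⟨r, hr, ε, hε, hmain⟩ := hL.eqOn_of_extremal (Λ * C) (m₀ := 1) (m₁ := 1) one_pos
  obtain ⟨ρ, hρ, hjoin⟩ := hbvp (Metric.ball y₀ r ∩ φ.target)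
    (inter_mem (Metric.ball_mem_nhds _ hr) (φ.open_target.mem_nhds hy₀))
  obtain ⟨U, hU, hopt⟩ := hγ.2 t₀ ht₀
  have hyc : ContinuousAt (φ ∘ γ) t₀ := ContinuousAt.comp (φ.continuousAt hsrc₀) hcont
  have hev : ∀ᶠ t in 𝓝 t₀, (t ∈ U ∧ t ∈ J) ∧ γ t ∈ φ.source ∧
      (φ ∘ γ) t ∈ Metric.ball y₀ r ∧ (φ ∘ γ) t ∈ Metric.ball y₀ ρ ∧
      ∀ v, chartLag h W s φ ((φ ∘ γ) t) v = 0 → ‖v‖ ≤ C := by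
    filter_upwards [hU, hJ.mem_nhds ht₀, hsrc, hyc.eventually (Metric.ball_mem_nhds _ hr),
      hyc.eventually (Metric.ball_mem_nhds _ hρ), hyc.eventually hbd] with t h1 h2 h3 h4 h5 h6
    exact ⟨⟨h1, h2⟩, h3, h4, h5, h6⟩
  obtain ⟨η, hη, hηev⟩ := Metric.eventually_nhds_iff_ball.1 hev
  rw [Real.ball_eq_Ioo] at hηev
  set δ := min (η / 2) (ε / 2) with hδ
  have hδpos : 0 < δ := by positivity
  have hδη : δ ≤ η / 2 := min_le_left _ _
  have hδε : δ ≤ ε / 2 := min_le_right _ _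
  set t₁ := t₀ - δ with ht₁
  set t₂ := t₀ + δ with ht₂
  have h12 : t₁ < t₂ := by linarith
  have hin : ∀ t ∈ Icc t₁ t₂, t ∈ Ioo (t₀ - η) (t₀ + η) := fun t ht =>
    ⟨by linarith [ht.1], by linarith [ht.2]⟩
  have hl := left_mem_Icc.2 h12.le
  have hr' := right_mem_Icc.2 h12.le
  have hP1 := hηev t₁ (hin t₁ hl)
  have hP2 := hηev t₂ (hin t₂ hr')
  have htraj := hγ.1 t₁ hP1.1.2 t₂ hP2.1.2 h12.le
  obtain ⟨S, hS⟩ := htraj.exists_finset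
  have hzc : ContinuousOn (φ ∘ γ) (Icc t₁ t₂) :=
    φ.continuousOn.comp htraj.1 fun t ht => (hηev t (hin t ht)).2.1
  set u : ℝ → E := fun t => dchart φ (γ t) (velocity E γ t) with hu
  have hzd : ∀ t ∈ Ioo t₁ t₂, t ∉ S → HasDerivAt (φ ∘ γ) (u t) t := fun t ht htS =>
    hasDerivAt_chart_comp hφ (hηev t (hin t (Ioo_subset_Icc_self ht))).2.1 (hS t ht htS).1
  have hzlag : ∀ t ∈ Ioo t₁ t₂, t ∉ S → chartLag h W s φ ((φ ∘ γ) t) (u t) = 0 :=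
    fun t ht htS => (chartLag_eq_zero_iff hφ (hηev t (hin t (Ioo_subset_Icc_self ht))).2.1
      (hs0 _).le _).2 (hS t ht htS).2
  have hzen : ∀ t ∈ Ioo t₁ t₂, t ∉ S → g ((φ ∘ γ) t) (u t) (u t) = c ^ 2 := fun t ht htS => by
    have := hzlag t ht htS
    rwa [chartLag_zero_const hW0 hsc, sub_eq_zero] at this
  have hdist : ‖(φ ∘ γ) t₂ - (φ ∘ γ) t₁‖ ≤ C * (t₂ - t₁) :=
    norm_sub_le_of_hasDerivAt_off_finset S h12.le hzc hzd fun t ht htS =>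
      (hηev t (hin t (Ioo_subset_Icc_self ht))).2.2.2.2 _ (hzlag t ht htS)
  -- The comparison geodesic `x` has the same ends and duration as `γ`; its constant energy `κ` is
  -- not yet known.
  obtain ⟨x, v, κ, hx1, hx2, hxv⟩ := hjoin _ hP1.2.2.2.1 _ hP2.2.2.2.1 t₁ t₂ h12
  have hxt : ∀ t ∈ Icc t₁ t₂, x t ∈ φ.target := fun t ht => (hxv t ht).2.1.2
  have hκ0 : 0 ≤ κ := by
    rw [← (hxv t₁ hl).2.2.1]
    rcases eq_or_ne (v t₁) 0 with h0 | h0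
    · simp [h0]
    · exact (chartForm_pos h hφ (hxt t₁ hl) _ h0).le
  have hκ : c ^ 2 ≤ κ := by
    by_contra! hlt
    -- For `κ = 0` the ends coincide, and the constant voyage of duration `0` beats `γ`. Otherwise
    -- the geodesic run at the permitted speed `c > √κ` arrives earlier than `γ`.
    rcases hκ0.eq_or_lt with h0 | hpos
    · have hv0 : ∀ t ∈ Icc t₁ t₂, v t = 0 := fun t ht => by
        by_contra hne
        have := chartForm_pos h hφ (hxt t ht) _ hne
        rw [(hxv t ht).2.2.1] at this
        linarith
      have hxx := (convex_Icc t₁ t₂).norm_image_sub_le_of_norm_hasDerivWithin_le (C := 0)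
        (fun t ht => (hxv t ht).1.self_of_nhds.1.hasDerivWithinAt)
        (fun t ht => by rw [hv0 t ht, norm_zero]) hl hr'
      rw [zero_mul, norm_le_zero_iff, sub_eq_zero, hx1, hx2] at hxx
      have hγeq : γ t₁ = γ t₂ := (φ.injOn hP1.2.1 hP2.2.1 hxx.symm)
      have hT : IsTrajectory h W s (fun _ => γ t₁) 0 0 := by
        refine ⟨continuousOn_const, ∅, fun a b ha hab hb => ?_, fun t ht => ?_⟩
        · linarith
        · simp at ht
      have := hopt t₁ hP1.1 t₂ hP2.1 h12.le _ 0 le_rfl hT rfl hγeq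
      linarith
    · set k := Real.sqrt κ with hk
      have hkpos : 0 < k := Real.sqrt_pos.2 hpos
      have hk2 : k ^ 2 = κ := Real.sq_sqrt hκ0
      have hkc : k < c := lt_of_pow_lt_pow_left₀ 2 hc.le (by rw [hk2]; exact hlt)
      set l := c / k with hldef
      have hlpos : 0 < l := by positivity
      have hlT : l * ((t₂ - t₁) / l) = t₂ - t₁ := by field_simp
      have hT0 : 0 < (t₂ - t₁) / l := div_pos (by linarith) hlpos
      have hmap : ∀ t ∈ Icc 0 ((t₂ - t₁) / l), t₁ + l * t ∈ Icc t₁ t₂ := fun t ht => by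
        have h1 : 0 ≤ l * t := mul_nonneg hlpos.le ht.1
        have h2 : l * t ≤ l * ((t₂ - t₁) / l) := by
          gcongr
          exact ht.2
        exact ⟨by linarith, by linarith⟩
      have hlin : ∀ t, HasDerivAt (fun t => t₁ + l * t) l t := fun t => by
        simpa using ((hasDerivAt_id t).const_mul l).const_add t₁
      have hnear : ∀ t ∈ Icc 0 ((t₂ - t₁) / l), ∀ᶠ q in 𝓝 t,
          HasDerivAt (fun t => x (t₁ + l * t)) (l • v (t₁ + l * q)) q ∧
          ContinuousAt (fun q => l • v (t₁ + l * q)) q := fun t ht => by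
        filter_upwards [(hlin t).continuousAt.eventually (hxv _ (hmap t ht)).1] with q hq
        refine ⟨HasDerivAt.scomp (g₁ := x) q hq.1 (hlin q), ?_⟩
        exact (ContinuousAt.comp (f := fun q => t₁ + l * q) (g := v) hq.2.continuousAt
          (hlin q).continuousAt).const_smul l
      have hT : IsTrajectory h W s (φ.symm ∘ fun t => x (t₁ + l * t)) 0 ((t₂ - t₁) / l) := by
        refine isTrajectory_symm_comp hφ (fun x => (hs0 x).le) (v := fun q => l • v (t₁ + l * q))
          (fun t ht => hxt _ (hmap t ht))
          (fun t ht => contDiffAt_one_of_hasDerivAt ((hnear t ht).mono fun q hq => hq.1)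
            ((hnear t ht).mono fun q hq => hq.2))
          (fun t ht => (hnear t ht).self_of_nhds.1) fun t ht => ?_
        rw [chartLag_zero_const hW0 hsc]
        simp only [map_smul, smul_apply, smul_eq_mul]
        rw [(hxv _ (hmap t ht)).2.2.1, ← hk2, hldef]
        field_simp
        ring
      have := hopt t₁ hP1.1 t₂ hP2.1 h12.le _ _ hT0.le hT
        (by simp only [Function.comp_apply, mul_zero, add_zero, hx1]
            exact φ.left_inv hP1.2.1)
        (by simp only [Function.comp_apply, hlT, add_sub_cancel, hx2]
            exact φ.left_inv hP2.2.1)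
      rw [le_div_iff₀ hlpos] at this
      have hl1 : 1 < l := (one_lt_div hkpos).2 hkc
      have : (t₂ - t₁) * 1 < (t₂ - t₁) * l := by
        gcongr
      linarith
  have hmem : ∀ t ∈ Icc t₁ t₂, DifferentiableAt ℝ g (x t) := fun t ht =>
    (contDiffAt_chartForm h hφ (hxt t ht)).differentiableAt (by norm_num)
  -- For the pure energy with multiplier `1`, the energy `c²` of `γ` is at most that of the
  -- geodesic, so the comparison applies.
  have heq := hmain t₁ t₂ x v (φ ∘ γ) u (fun t => lagV g 0 (x t) (v t)) (fun _ => 1) S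
    (by linarith) (fun t ht => (hxv t ht).2.1.1)
    (fun t ht => by
      have h1 := (hxv t ht).2.2.2
      have h2 : Λ * ‖(φ ∘ γ) t₂ - (φ ∘ γ) t₁‖ ≤ Λ * (C * (t₂ - t₁)) := by gcongr
      have h3 : ‖v t‖ * (t₂ - t₁) ≤ Λ * C * (t₂ - t₁) := by linarith
      exact le_of_mul_le_mul_right h3 (by linarith))
    (fun t ht => ⟨le_rfl, le_rfl⟩) (fun t ht => (hxv t ht).1.self_of_nhds.1)
    (fun t ht => (one_smul _ _).symm)
    (fun t ht => by
      rw [one_smul]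
      exact hasDerivAt_momentum (hmem t ht)
        (apply_geodesicAcc (chartForm_pos h hφ (hxt t ht)) _)
        (hxv t ht).1.self_of_nhds.1 (hxv t ht).1.self_of_nhds.2)
    hzc (fun t ht => (hηev t (hin t ht)).2.2.1) hzd
    (fun t ht htS => by
      rw [lag_metric, lag_metric, hzen t ht htS, (hxv t (Ioo_subset_Icc_self ht)).2.2.1]
      exact hκ)
    hx1.symm hx2.symm
  have hκeq : κ = c ^ 2 := by
    obtain ⟨t, ht, htS⟩ := (Ioo_infinite h12).exists_notMem_finset S
    have ht' := Ioo_subset_Icc_self ht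
    have hu_eq : u t = v t := by
      refine (hzd t ht htS).unique ((hxv t ht').1.self_of_nhds.1.congr_of_eventuallyEq ?_)
      filter_upwards [Ioo_mem_nhds ht.1 ht.2] with q hq
      exact heq (Ioo_subset_Icc_self hq)
    rw [← (hxv t ht').2.2.1, ← hzen t ht htS, hu_eq, heq ht']
  have ht₀in : t₀ ∈ Icc t₁ t₂ := ⟨by linarith, by linarith⟩
  refine ⟨φ, hφ, hsrc, x, v, ?_, hcont, (hxv t₀ ht₀in).1, ?_⟩
  · filter_upwards [Icc_mem_nhds (show t₁ < t₀ by linarith) (show t₀ < t₂ by linarith)] with t ht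
    exact heq ht
  · rw [(hxv t₀ ht₀in).2.2.1, hκeq]

variable [T2Space M]

/-- Solutions of the navigation problem exist for all initial positions and velocities. -/
theorem exists_isSolution
    (hW : ContMDiff 𝓘(ℝ, E) 𝓘(ℝ, E).tangent ∞ (fun x => (⟨x, W x⟩ : TangentBundle 𝓘(ℝ, E) M)))
    (hsm : ContMDiff 𝓘(ℝ, E) 𝓘(ℝ, ℝ) ∞ s) (hs1 : ∀ x, s x ≤ 1)
    (hWs : ∀ x, hnorm h x (W x) < s x) (x₀ : M) (u : TangentSpace 𝓘(ℝ, E) x₀)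
    (hu : hnorm h x₀ (u - W x₀) = s x₀) :
    ∃ ε > 0, ∃ γ : ℝ → M, IsSolution h W s γ (Ioo (-ε) ε) ∧
      hnorm h (γ 0) (velocity E γ 0) = hnorm h x₀ u := by
  have hs0 : ∀ x, 0 < s x := fun x => (Real.sqrt_nonneg _).trans_lt (hWs x)
  set φ := chartAt E x₀ with hφdef
  have hφ : φ ∈ atlas E M := chart_mem_atlas E x₀
  have hx₀ : x₀ ∈ φ.source := mem_chart_source E x₀
  have hy₀ : φ x₀ ∈ φ.target := φ.map_source hx₀
  have hL := isLagrangianAt_chart (h := h) hW hsm hφ hy₀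
  have hu' := (chartLag_eq_zero_iff hφ hx₀ (hs0 _).le u).2 hu
  rw [chartLag, lag_wind (chartForm_symm h φ _), sub_eq_zero] at hu'
  obtain ⟨x, v, p, μ, hx0, hv0, hev⟩ := exists_extremal hL.contDiffAt_A
    (contDiffAt_chartWind hW hφ hy₀) (contDiffAt_comp_chart_symm hsm hφ hy₀) hL.symm hL.pos
    (hs0 _) hu'
  have hxc : ContinuousAt x 0 := hev.self_of_nhds.1.continuousAt
  have htar : ∀ᶠ t in 𝓝 0, x t ∈ φ.target :=
    hxc.eventually (φ.open_target.mem_nhds (by rwa [hx0]))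
  obtain ⟨ε, hε, hall⟩ := Metric.eventually_nhds_iff_ball.1 (hev.and htar)
  rw [Real.ball_eq_Ioo, zero_sub, zero_add] at hall
  have hnear : ∀ t ∈ Ioo (-ε) ε, ∀ᶠ r in 𝓝 t, r ∈ Ioo (-ε) ε := fun t ht =>
    Ioo_mem_nhds ht.1 ht.2
  have hcomp : ∀ t ∈ Ioo (-ε) ε, φ ((φ.symm ∘ x) t) = x t := fun t ht =>
    φ.right_inv (hall t ht).2
  have hd : ∀ t ∈ Ioo (-ε) ε, HasDerivAt (φ ∘ (φ.symm ∘ x)) (v t) t := fun t ht =>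
    (hall t ht).1.1.congr_of_eventuallyEq ((hnear t ht).mono fun r hr => hcomp r hr)
  have h0 : (0 : ℝ) ∈ Ioo (-ε) ε := ⟨by linarith, hε⟩
  refine ⟨ε, hε, φ.symm ∘ x, ⟨fun a ha b hb hab => ?_, fun t₀ ht₀ => ?_⟩, ?_⟩
  · have hsub : ∀ t ∈ Icc a b, t ∈ Ioo (-ε) ε := fun t ht =>
      ⟨ha.1.trans_le ht.1, ht.2.trans_lt hb.2⟩
    refine isTrajectory_symm_comp hφ (fun x => (hs0 x).le) (v := v)
      (fun t ht => (hall t (hsub t ht)).2) (fun t ht => ?_)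
      (fun t ht => (hall t (hsub t ht)).1.1) (fun t ht => (hall t (hsub t ht)).1.2.2.2.2.2.2)
    exact contDiffAt_one_of_hasDerivAt
      ((hnear t (hsub t ht)).mono fun r hr => (hall r hr).1.1)
      ((hnear t (hsub t ht)).mono fun r hr => (hall r hr).1.2.2.2.2.1)
  · have hn := hnear t₀ ht₀
    obtain ⟨U, hU, hopt⟩ := exists_nhds_optimal (h := h) (γ := φ.symm ∘ x) (v := v) (p := p)
      (μ := μ) hW hsm hs1 hWs hφ
      (hn.mono fun t ht => φ.map_target (hall t ht).2) (hall t₀ ht₀).1.2.2.2.2.1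
      (hall t₀ ht₀).1.2.2.2.2.2.1 (hall t₀ ht₀).1.2.2.2.1 (hn.mono hd)
      (hn.mono fun t ht => by rw [hcomp t ht]; exact (hall t ht).1.2.1)
      (hn.mono fun t ht => by rw [hcomp t ht]; exact (hall t ht).1.2.2.1)
      (hn.mono fun t ht => by rw [hcomp t ht]; exact (hall t ht).1.2.2.2.2.2.2)
    exact ⟨U, hU, fun t₁ ht₁ t₂ ht₂ => hopt t₁ ht₁.1 t₂ ht₂.1⟩
  · have hsrc : (φ.symm ∘ x) 0 ∈ φ.source := φ.map_target (hall 0 h0).2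
    have hc : ContinuousAt (φ.symm ∘ x) 0 :=
      ContinuousAt.comp (φ.continuousAt_symm (hall 0 h0).2) hxc
    rw [hnorm, hnorm, inner_eq_chartForm h hφ hsrc, dchart_velocity hφ hc hsrc (hd 0 h0),
      hcomp 0 h0, hx0, hv0, inner_eq_chartForm h hφ hx₀]

/-- Without wind, geodesics traversed at the ship's own constant speed solve the navigation
problem. -/
theorem isSolution_of_isGeodesicOfSpeed
    (hW : ContMDiff 𝓘(ℝ, E) 𝓘(ℝ, E).tangent ∞ (fun x => (⟨x, W x⟩ : TangentBundle 𝓘(ℝ, E) M)))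
    (hsm : ContMDiff 𝓘(ℝ, E) 𝓘(ℝ, ℝ) ∞ s) (hs1 : ∀ x, s x ≤ 1)
    (hWs : ∀ x, hnorm h x (W x) < s x) (hW0 : ∀ x, W x = 0) {c : ℝ} (hsc : ∀ x, s x = c)
    {J : Set ℝ} (hJ : IsOpen J) (hJc : J.OrdConnected) {γ : ℝ → M}
    (hγ : IsGeodesicOfSpeed h c γ J) : IsSolution h W s γ J := by
  have hs0 : ∀ x, 0 < s x := fun x => (Real.sqrt_nonneg _).trans_lt (hWs x)
  obtain ⟨hgeo, hspeed⟩ := hγ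
  refine ⟨fun a ha b hb hab => ?_, fun t₀ ht₀ => ?_⟩
  · have hsub : Icc a b ⊆ J := hJc.out ha hb
    refine isTrajectory_of_contMDiffAt (fun t ht => ?_) fun t ht => ?_
    · obtain ⟨φ, hφ, hsrc, hcd, -⟩ := hgeo t (hsub ht)
      exact contMDiffAt_of_chart hφ (continuousAt_of_chart hsrc hcd.continuousAt)
        hsrc.self_of_nhds (hcd.of_le one_le_two)
    · rw [hW0, sub_zero, hspeed t (hsub ht), hsc]
  · obtain ⟨φ, hφ, hsrc, hcd, heq⟩ := hgeo t₀ ht₀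
    set g := chartForm h φ with hg
    set v : ℝ → E := deriv (φ ∘ γ) with hv
    have hx : ∀ᶠ t in 𝓝 t₀, HasDerivAt (φ ∘ γ) (v t) t :=
      (hcd.eventually (by simp)).mono fun t ht => (ht.differentiableAt (by norm_num)).hasDerivAt
    have hvc : ContDiffAt ℝ 1 v t₀ := by
      have := (contDiffAt_succ_iff_hasFDerivAt (n := 1)).1 (by norm_num; exact hcd)
      obtain ⟨f', ⟨U, hU, hf'⟩, hc'⟩ := this
      refine (hc'.clm_apply (contDiffAt_const (c := (1 : ℝ)))).congr_of_eventuallyEq ?_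
      filter_upwards [hU] with t ht
      exact (hf' t ht).hasDerivAt.deriv
    have hvd : ∀ᶠ t in 𝓝 t₀, HasDerivAt v (deriv v t) t :=
      (hvc.eventually (by simp)).mono fun t ht => (ht.differentiableAt (by norm_num)).hasDerivAt
    have hsc' : s ∘ φ.symm = fun _ => c := funext fun y => hsc _
    -- Without wind and with constant own speed, the navigation Lagrangian is the energy minus a
    -- constant, so both have the same Euler–Lagrange equation.
    have hlagX : ∀ y u : E, lagX g (windB g (chartWind W φ))
        (windD g (chartWind W φ) (s ∘ φ.symm)) y u = lagX g 0 0 y u := by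
      intro y u
      rw [chartWind_zero hW0, hsc', windB_zero, windD_zero_const]
      ext w
      rw [lagX_apply, lagX_apply, fderiv_fun_const, fderiv_zero, fderiv_zero]
    obtain ⟨U, hU, hopt⟩ := exists_nhds_optimal (h := h) (γ := γ) (v := v)
      (p := fun t => lagV g 0 (φ (γ t)) (v t)) (μ := fun _ => 1) hW hsm hs1 hWs hφ hsrc
      hvc.continuousAt continuousAt_const one_pos hx
      (Eventually.of_forall fun t => by rw [chartWind_zero hW0, windB_zero, one_smul])
      (by
        filter_upwards [hsrc, hx, hvd, heq] with t h1 h2 h3 h4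
        rw [hlagX, one_smul]
        exact hasDerivAt_momentum (x := φ ∘ γ)
          ((contDiffAt_chartForm h hφ (φ.map_source h1)).differentiableAt (by norm_num))
          ((geodesic_equation_iff h hφ (φ.map_source h1) _ _).1 h4) h2 h3)
      (by
        filter_upwards [eventually_eventually_nhds.2 hsrc, hx, hJ.mem_nhds ht₀] with t h1 h2 h3
        have := hspeed t h3
        have hct := continuousAt_of_chart h1 h2.continuousAt
        rw [← dchart_velocity hφ hct h1.self_of_nhds h2,
          chartLag_eq_zero_iff hφ h1.self_of_nhds (hs0 _).le, hW0, sub_zero, this, hsc])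
    exact ⟨U, hU, fun t₁ ht₁ t₂ ht₂ => hopt t₁ ht₁.1 t₂ ht₂.1⟩

/-- If all solutions of the navigation problem are geodesics of the same speed, there is no wind
and the ship's own speed is constant. -/
theorem wind_eq_zero_of_isGeodesicOfSpeed [Nontrivial E]
    (hW : ContMDiff 𝓘(ℝ, E) 𝓘(ℝ, E).tangent ∞ (fun x => (⟨x, W x⟩ : TangentBundle 𝓘(ℝ, E) M)))
    (hsm : ContMDiff 𝓘(ℝ, E) 𝓘(ℝ, ℝ) ∞ s) (hs1 : ∀ x, s x ≤ 1)
    (hWs : ∀ x, hnorm h x (W x) < s x) {c : ℝ}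
    (hall : ∀ J : Set ℝ, IsOpen J → J.OrdConnected → ∀ γ : ℝ → M,
      IsSolution h W s γ J → IsGeodesicOfSpeed h c γ J) :
    (∀ x, W x = 0) ∧ ∀ x, s x ^ 2 = c ^ 2 := by
  have hs0 : ∀ x, 0 < s x := fun x => (Real.sqrt_nonneg _).trans_lt (hWs x)
  -- Each admissible velocity `W + u` is, up to its norm, the initial velocity of some solution,
  -- whose speed is `c` by assumption.
  have hspeed : ∀ (x : M) (u : TangentSpace 𝓘(ℝ, E) x), h.inner x u u = s x ^ 2 →
      h.inner x (W x + u) (W x + u) = c ^ 2 := by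
    intro x u hu
    obtain ⟨ε, hε, γ, hγ, hγ0⟩ := exists_isSolution (h := h) hW hsm hs1 hWs x (W x + u)
      (by rw [add_sub_cancel_left, hnorm_eq_iff h _ (hs0 x).le, hu])
    have h1 := (hall _ isOpen_Ioo ordConnected_Ioo γ hγ).2 0 ⟨by linarith, hε⟩
    rw [hγ0] at h1
    rw [← hnorm_sq, h1]
  -- Both `u` and `-u` are allowed; subtracting the two speed identities leaves `4 h(W, u) = 0`.
  have horth : ∀ (x : M) (u : TangentSpace 𝓘(ℝ, E) x), h.inner x u u = s x ^ 2 →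
      h.inner x (W x) u = 0 := by
    intro x u hu
    have h1 := hspeed x u hu
    have h2 := hspeed x (-u) (by simpa using hu)
    have h3 := h.symm x u (W x)
    simp only [map_add, map_neg, add_apply, neg_apply] at h1 h2
    linarith
  have hscale : ∀ (x : M) (u : TangentSpace 𝓘(ℝ, E) x), u ≠ 0 → ∃ k : ℝ, k ≠ 0 ∧
      h.inner x (k • u) (k • u) = s x ^ 2 := by
    intro x u hu
    have hpos := h.pos x u hu
    refine ⟨s x / Real.sqrt (h.inner x u u), (div_pos (hs0 x) (Real.sqrt_pos.2 hpos)).ne', ?_⟩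
    simp only [map_smul, smul_apply, smul_eq_mul]
    rw [← mul_assoc, ← sq, div_pow, Real.sq_sqrt hpos.le]
    field_simp
  have hW0 : ∀ x, W x = 0 := by
    intro x
    by_contra hne
    obtain ⟨k, hk, hks⟩ := hscale x (W x) hne
    have := horth x _ hks
    rw [map_smul, smul_eq_mul] at this
    exact (mul_ne_zero hk (h.pos x _ hne).ne') this
  refine ⟨hW0, fun x => ?_⟩
  obtain ⟨u, hu⟩ := exists_ne (0 : E)
  obtain ⟨k, -, hks⟩ := hscale x u hu
  have := hspeed x _ hks
  rw [hW0, zero_add] at this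
  rw [← this, hks]

end Solutions

end Zermelo

/-! ### The equivalences -/

theorem mainTheorem4
    {E : Type*} [NormedAddCommGroup E] [NormedSpace ℝ E] [FiniteDimensional ℝ E] [Nontrivial E]
    {M : Type*} [TopologicalSpace M] [T2Space M] [ChartedSpace E M] [IsManifold 𝓘(ℝ, E) ∞ M]
    (h : Zermelo.Metric E M)
    (W : ∀ x : M, TangentSpace 𝓘(ℝ, E) x)
    (hW : ContMDiff 𝓘(ℝ, E) 𝓘(ℝ, E).tangent ∞ (fun x => (⟨x, W x⟩ : TangentBundle 𝓘(ℝ, E) M)))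
    (s : M → ℝ) (hs : ContMDiff 𝓘(ℝ, E) 𝓘(ℝ, ℝ) ∞ s)
    (hs1 : ∀ x, s x ≤ 1) (hWs : ∀ x, Zermelo.hnorm h x (W x) < s x) :
    ((∃ c : ℝ, 0 < c ∧ ∀ (J : Set ℝ), IsOpen J → J.OrdConnected → ∀ γ : ℝ → M,
        Zermelo.IsSolution h W s γ J → Zermelo.IsGeodesicOfSpeed h c γ J) ↔
      (∀ x, W x = 0) ∧ ∃ k : ℝ, ∀ x, s x ^ 2 = k) ∧
    ((∃ c : ℝ, 0 < c ∧ ∀ (J : Set ℝ), IsOpen J → J.OrdConnected → ∀ γ : ℝ → M,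
        (Zermelo.IsSolution h W s γ J ↔ Zermelo.IsGeodesicOfSpeed h c γ J)) ↔
      (∀ x, W x = 0) ∧ ∃ k : ℝ, ∀ x, s x ^ 2 = k) := by
  have hs0 : ∀ x, 0 < s x := fun x => (Real.sqrt_nonneg _).trans_lt (hWs x)
  have forward : (∃ c : ℝ, 0 < c ∧ ∀ (J : Set ℝ), IsOpen J → J.OrdConnected → ∀ γ : ℝ → M,
      Zermelo.IsSolution h W s γ J → Zermelo.IsGeodesicOfSpeed h c γ J) →
      (∀ x, W x = 0) ∧ ∃ k : ℝ, ∀ x, s x ^ 2 = k := by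
    rintro ⟨c, -, hall⟩
    obtain ⟨h1, h2⟩ := Zermelo.wind_eq_zero_of_isGeodesicOfSpeed hW hs hs1 hWs hall
    exact ⟨h1, _, h2⟩
  have backward : ((∀ x, W x = 0) ∧ ∃ k : ℝ, ∀ x, s x ^ 2 = k) →
      ∃ c : ℝ, 0 < c ∧ ∀ (J : Set ℝ), IsOpen J → J.OrdConnected → ∀ γ : ℝ → M,
        (Zermelo.IsSolution h W s γ J ↔ Zermelo.IsGeodesicOfSpeed h c γ J) := by
    rintro ⟨hW0, k, hk⟩
    rcases isEmpty_or_nonempty M with hM | ⟨⟨x₀⟩⟩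
    -- On an empty manifold there are no curves and any constant will do.
    · exact ⟨1, one_pos, fun J _ _ γ => (hM.false (γ 0)).elim⟩
    have hsc : ∀ x, s x = s x₀ := fun x =>
      (sq_eq_sq₀ (hs0 x).le (hs0 x₀).le).1 ((hk x).trans (hk x₀).symm)
    exact ⟨s x₀, hs0 x₀, fun J hJ hJc γ =>
      ⟨Zermelo.isGeodesicOfSpeed_of_isSolution hW hs1 hW0 (hs0 x₀) hsc hJ,
        Zermelo.isSolution_of_isGeodesicOfSpeed hW hs hs1 hWs hW0 hsc hJ hJc⟩⟩
  refine ⟨⟨forward, fun H => ?_⟩, ⟨fun ⟨c, hc, H⟩ => forward ⟨c, hc, fun J hJ hJc γ =>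
    (H J hJ hJc γ).1⟩, backward⟩⟩
  obtain ⟨c, hc, H⟩ := backward H
  exact ⟨c, hc, fun J hJ hJc γ => (H J hJ hJc γ).1⟩
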